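/- Let $2 \le k \le n$. Let $(M^n,h)$ and $(L^k,g)$ be oriented smooth Riemannian manifolds without boundary, of dimensions $n$ and $k$, with Riemannian volume forms $\mathsf{vol}_M$ and $\mathsf{vol}_L$; neither is assumed compact. Let $\alpha$ be a smooth $(n-k)$-form on $M$ that is a calibration, that is, $$|\alpha(v_1,\dots,v_{n-k})| \le |v_1\wedge\dots\wedge v_{n-k}| \quad\text{for all } x\in M \text{ and } v_1,\dots,v_{n-k}\in T_xM,$$ and suppose that $d\alpha=0$. For a smooth map $u\colon M\to L$ let $|du|=\sqrt{\operatorname{tr}_h(u^*g)}$. Let $u\colon M\to L$ be a Smith submersion with respect to $\alpha$, that is, a smooth map such that $$\alpha\wedge u^*\mathsf{vol}_L=\frac{1}{(\sqrt k)^k}\,|du|^k\,\mathsf{vol}_M \quad\text{at every point of } M.$$ Then $u$ is $k$-harmonic: the section $|du|^{k-2}du$ of $T^*M\otimes u^*TL$ is differentiable at every point of $M$, and its divergence, the $k$-tension of $u$, vanishes everywhere: $$\tau_k(u)=\operatorname{Div}\big(|du|^{k-2}du\big)=0.$$ Here $(\operatorname{Div}B)=\sum_i(\nabla_{e_i}B)(e_i)$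 for a local orthonormal frame $e_1,\dots,e_n$ of $M$, where $\nabla$ is the connection on $T^*M\otimes u^*TL$ induced by the Levi-Civita connections of $h$ and $g$, and $|du|^{0}$ means $1$ when $k=2$. -/

import Mathlib

open scoped Manifold ContDiff Topology

noncomputable section

namespace SmithSubmersion

/-! Linear algebra on a finite-dimensional space with an inner product `H` -/

section LinearAlgebra

variable {V W : Type*} [AddCommGroup V] [Module ℝ V] [AddCommGroup W] [Module ℝ W]

/-- The Gram matrix `H (vᵢ, vⱼ)` of a family of vectors. -/
def gram {ι : Type*} (H : V → V → ℝ) (v : ι → V) : Matrix ι ι ℝ :=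
  Matrix.of fun i j => H (v i) (v j)

/-- The trace `H^{ij} B_{ij}` of a bilinear form `B` with respect to the inner product `H`, computed
in a basis `b` (on which it does not depend). In an `H`-orthonormal basis it is `∑ i, B (eᵢ, eᵢ)`. -/
def metricTrace {n : ℕ} (b : Module.Basis (Fin n) ℝ V) (H B : V → V → ℝ) : ℝ :=
  ∑ i, ∑ j, (gram H b)⁻¹ i j * B (b i) (b j)

open Classical in
/-- The volume form of the inner product `H` and the orientation `o`, computed in a basis `b` (on
which it does not depend): `± √(det H_{ij}) e¹ ∧ ⋯ ∧ eⁿ`, where the sign is `+` if and only if `b` is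
positively oriented. It is the form with value `1` on every oriented orthonormal basis. -/
def volumeForm {n : ℕ} (b : Module.Basis (Fin n) ℝ V) (H : V → V → ℝ)
    (o : Orientation ℝ V (Fin n)) : V [⋀^Fin n]→ₗ[ℝ] ℝ :=
  ((if b.orientation = o then 1 else -1) * √(gram H b).det) • b.det

/-- The wedge product of alternating forms, in the normalization
`(α ∧ β) (v₁, …, v_{m+k}) = ∑ sign σ • α (v_{σ 1}, …, v_{σ m}) * β (v_{σ (m+1)}, …, v_{σ (m+k)})`,
the sum being over the `(m, k)`-shuffles. -/
def wedge {m k : ℕ} (α : V [⋀^Fin m]→ₗ[ℝ] ℝ) (β : V [⋀^Fin k]→ₗ[ℝ] ℝ) :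
    V [⋀^Fin (m + k)]→ₗ[ℝ] ℝ :=
  ((LinearMap.mul' ℝ ℝ).compAlternatingMap (α.domCoprod β)).domDomCongr finSumFinEquiv

end LinearAlgebra

/-! Manifolds, modelled on `ℝⁿ` (so without boundary) -/

section Manifold

variable {n : ℕ} {M : Type*} [TopologicalSpace M] [ChartedSpace (EuclideanSpace ℝ (Fin n)) M]

/-- The standard basis of `T_x M`, that is, the coordinate basis of the preferred chart at `x`. -/
def tangentBasis (x : M) : Module.Basis (Fin n) ℝ (TangentSpace (𝓡 n) x) :=
  (EuclideanSpace.basisFun (Fin n) ℝ).toBasis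

/-- For a point with coordinates `y` in the preferred chart `φ` at `x₀`, the isomorphism
`D(φ⁻¹)_y` from `ℝⁿ` to the tangent space of `M` there. -/
def coordMap (x₀ : M) (y : EuclideanSpace ℝ (Fin n)) :
    EuclideanSpace ℝ (Fin n) →L[ℝ] TangentSpace (𝓡 n) ((extChartAt (𝓡 n) x₀).symm y) :=
  mfderiv 𝓘(ℝ, EuclideanSpace ℝ (Fin n)) (𝓡 n) (extChartAt (𝓡 n) x₀).symm y

/-- The coordinate vector field `∂ᵢ` of the preferred chart at `x₀`, at the point with
coordinates `y`. -/
def coordVec (x₀ : M) (i : Fin n) (y : EuclideanSpace ℝ (Fin n)) :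
    TangentSpace (𝓡 n) ((extChartAt (𝓡 n) x₀).symm y) :=
  coordMap x₀ y (EuclideanSpace.single i 1)

/-- The partial derivative `∂ᵢ f` of a real function on `ℝⁿ`. -/
def pd (i : Fin n) (f : EuclideanSpace ℝ (Fin n) → ℝ) (y : EuclideanSpace ℝ (Fin n)) : ℝ :=
  fderiv ℝ f y (EuclideanSpace.single i 1)

variable (n M) in
/-- An orientation of `M`: an orientation of each tangent space, which is locally constant in the
local trivializations of `TM` that come from the charts. -/
structure ManifoldOrientation [IsManifold (𝓡 n) ∞ M] where
  /-- The orientation of `T_x M`. -/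
  at_ (x : M) : Orientation ℝ (TangentSpace (𝓡 n) x) (Fin n)
  locally_const : ∀ x₀ : M, ∃ o₀ : Orientation ℝ (EuclideanSpace ℝ (Fin n)) (Fin n),
    ∀ᶠ x in 𝓝 x₀, ∀ hx : x ∈ (trivializationAt (EuclideanSpace ℝ (Fin n))
        (TangentSpace (𝓡 n) : M → Type _) x₀).baseSet,
      Orientation.map (Fin n) ((trivializationAt (EuclideanSpace ℝ (Fin n))
        (TangentSpace (𝓡 n) : M → Type _) x₀).continuousLinearEquivAt ℝ x hx).toLinearEquiv
        (at_ x) = o₀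

variable (n M) in
/-- A smooth Riemannian metric on `M`. -/
abbrev RiemMetric [IsManifold (𝓡 n) ∞ M] :=
  Bundle.ContMDiffRiemannianMetric (𝓡 n) ∞ (EuclideanSpace ℝ (Fin n))
    (TangentSpace (𝓡 n) : M → Type _)

/-- The inner product of the metric `h` on `T_x M`. -/
def ip [IsManifold (𝓡 n) ∞ M] (h : RiemMetric n M) (x : M) (v w : TangentSpace (𝓡 n) x) : ℝ :=
  h.inner x v w

/-- The Riemannian volume form of an oriented Riemannian manifold, at the point `x`. -/
def riemVol [IsManifold (𝓡 n) ∞ M] (h : RiemMetric n M) (o : ManifoldOrientation n M) (x : M) :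
    (TangentSpace (𝓡 n) x) [⋀^Fin n]→ₗ[ℝ] ℝ :=
  volumeForm (tangentBasis x) (ip h x) (o.at_ x)

/-- The expression in the preferred chart at `x₀` of a form on `M`. -/
def chartForm {m : ℕ} (α : ∀ x : M, (TangentSpace (𝓡 n) x) [⋀^Fin m]→L[ℝ] ℝ) (x₀ : M)
    (y : EuclideanSpace ℝ (Fin n)) : (EuclideanSpace ℝ (Fin n)) [⋀^Fin m]→L[ℝ] ℝ :=
  (α ((extChartAt (𝓡 n) x₀).symm y)).compContinuousLinearMap (coordMap x₀ y)

variable (n M) in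
/-- A smooth differential form of degree `m` on `M`. -/
structure SmoothForm (m : ℕ) where
  /-- The form at the point `x`. -/
  at_ (x : M) : (TangentSpace (𝓡 n) x) [⋀^Fin m]→L[ℝ] ℝ
  smooth : ∀ x₀ : M, ContDiffOn ℝ ∞ (chartForm at_ x₀) (extChartAt (𝓡 n) x₀).target

/-- The equation `dα = 0`. -/
def SmoothForm.IsClosed {m : ℕ} (α : SmoothForm n M m) : Prop :=
  ∀ x₀ : M, ∀ y ∈ (extChartAt (𝓡 n) x₀).target, extDeriv (chartForm α.at_ x₀) y = 0

/-- A form is a calibration if it has comass at most one, that is, if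
`|α (v₁, …, v_m)| ≤ |v₁ ∧ ⋯ ∧ v_m| = √(det h(vᵢ, vⱼ))` for all tangent vectors. -/
def IsCalibration [IsManifold (𝓡 n) ∞ M] (h : RiemMetric n M) {m : ℕ} (α : SmoothForm n M m) :
    Prop :=
  ∀ (x : M) (v : Fin m → TangentSpace (𝓡 n) x), |α.at_ x v| ≤ √(gram (ip h x) v).det

/-- The Christoffel symbol `Γˡᵢⱼ = ½ h^{lr} (∂ᵢ h_{jr} + ∂ⱼ h_{ir} - ∂ᵣ h_{ij})` of the Levi-Civita
connection in the preferred chart at `x₀`, at the point with coordinates `y`. -/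
def christoffel [IsManifold (𝓡 n) ∞ M] (h : RiemMetric n M) (x₀ : M)
    (y : EuclideanSpace ℝ (Fin n)) (l i j : Fin n) : ℝ :=
  let H : EuclideanSpace ℝ (Fin n) → Matrix (Fin n) (Fin n) ℝ := fun z =>
    gram (ip h ((extChartAt (𝓡 n) x₀).symm z)) fun i => coordVec x₀ i z
  (1 / 2) * ∑ r, (H y)⁻¹ l r *
    (pd i (fun z => H z j r) y + pd j (fun z => H z i r) y - pd r (fun z => H z i j) y)

end Manifold

/-! Maps between manifolds -/

section Maps

variable {n k : ℕ} {M L : Type*}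
  [TopologicalSpace M] [ChartedSpace (EuclideanSpace ℝ (Fin n)) M]
  [TopologicalSpace L] [ChartedSpace (EuclideanSpace ℝ (Fin k)) L]

variable (n k) in
/-- A (not necessarily smooth) section of `T*M ⊗ u*TL`. -/
abbrev HomSection (u : M → L) :=
  ∀ x : M, TangentSpace (𝓡 n) x →L[ℝ] TangentSpace (𝓡 k) (u x)

/-- The differential `du`, a section of `T*M ⊗ u*TL`. -/
def differential (u : M → L) : HomSection n k u := fun x => mfderiv (𝓡 n) (𝓡 k) u x

/-- The coordinates `û = ψ ∘ u ∘ φ⁻¹` of a map in the preferred charts `φ` at `x₀` and `ψ` at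
`u x₀`. -/
def coordRep (u : M → L) (x₀ : M) (y : EuclideanSpace ℝ (Fin n)) : EuclideanSpace ℝ (Fin k) :=
  extChartAt (𝓡 k) (u x₀) (u ((extChartAt (𝓡 n) x₀).symm y))

/-- The components `B_jᵃ = dyᵃ (B (∂ⱼ))` of a section of `T*M ⊗ u*TL` in the preferred charts at `x₀`
and `u x₀`. -/
def coordComp {u : M → L} (B : HomSection n k u) (x₀ : M) (j : Fin n) (a : Fin k)
    (y : EuclideanSpace ℝ (Fin n)) : ℝ :=
  (show EuclideanSpace ℝ (Fin k) from
    mfderiv (𝓡 k) 𝓘(ℝ, EuclideanSpace ℝ (Fin k)) (extChartAt (𝓡 k) (u x₀))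
      (u ((extChartAt (𝓡 n) x₀).symm y))
      (B ((extChartAt (𝓡 n) x₀).symm y) (coordVec x₀ j y))) a

/-- Differentiability at `x₀` of a section of `T*M ⊗ u*TL`. -/
def HomSection.DifferentiableAt {u : M → L} (B : HomSection n k u) (x₀ : M) : Prop :=
  ∀ (j : Fin n) (a : Fin k),
    _root_.DifferentiableAt ℝ (coordComp B x₀ j a) (extChartAt (𝓡 n) x₀ x₀)

variable [IsManifold (𝓡 n) ∞ M] [IsManifold (𝓡 k) ∞ L]

/-- The components `(∇ᵢ B)_jᵃ = ∂ᵢ B_jᵃ - Γˡᵢⱼ B_lᵃ + Γᵃ_{bc}(û) ∂ᵢ ûᵇ B_jᶜ` at the point `x₀` of the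
covariant derivative of a section of `T*M ⊗ u*TL`, for the connection induced by the Levi-Civita
connections of `h` and `g`. -/
def covDeriv (h : RiemMetric n M) (g : RiemMetric k L) {u : M → L} (B : HomSection n k u) (x₀ : M)
    (i j : Fin n) (a : Fin k) : ℝ :=
  let y₀ : EuclideanSpace ℝ (Fin n) := extChartAt (𝓡 n) x₀ x₀
  pd i (coordComp B x₀ j a) y₀
    - ∑ l, christoffel h x₀ y₀ l i j * coordComp B x₀ l a y₀
    + ∑ b, ∑ c, christoffel g (u x₀) (extChartAt (𝓡 k) (u x₀) (u x₀)) a b c *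
        pd i (fun y => coordRep u x₀ y b) y₀ * coordComp B x₀ j c y₀

/-- The divergence `Div B = h^{ij} ∇ᵢ B_j`, a section of `u*TL`. -/
def divergence (h : RiemMetric n M) (g : RiemMetric k L) {u : M → L} (B : HomSection n k u)
    (x₀ : M) : TangentSpace (𝓡 k) (u x₀) :=
  ∑ a, (∑ i, ∑ j, (gram (ip h x₀) (tangentBasis x₀))⁻¹ i j * covDeriv h g B x₀ i j a) •
    tangentBasis (u x₀) a

/-- The norm `|du| = √(tr_h (u^* g))` of the differential. -/
def normDu (h : RiemMetric n M) (g : RiemMetric k L) (u : M → L) (x : M) : ℝ :=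
  √(metricTrace (tangentBasis x) (ip h x)
    fun v w => ip g (u x) (differential u x v) (differential u x w))

/-- The section `|du|^(p - 2) du` of `T*M ⊗ u*TL`. -/
def pDifferential (p : ℝ) (h : RiemMetric n M) (g : RiemMetric k L) (u : M → L) :
    HomSection n k u :=
  fun x => (normDu h g u x ^ (p - 2)) • differential u x

/-- The `p`-tension `τ_p(u) = Div (|du|^(p - 2) du)`. -/
def pTension (p : ℝ) (h : RiemMetric n M) (g : RiemMetric k L) (u : M → L) (x : M) :
    TangentSpace (𝓡 k) (u x) :=
  divergence h g (pDifferential p h g u) x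

end Maps

section Smith

variable {m k : ℕ} {M L : Type*}
  [TopologicalSpace M] [ChartedSpace (EuclideanSpace ℝ (Fin (m + k))) M]
  [TopologicalSpace L] [ChartedSpace (EuclideanSpace ℝ (Fin k)) L]
  [IsManifold (𝓡 (m + k)) ∞ M] [IsManifold (𝓡 k) ∞ L]

/-- The smooth map `u : (Mⁿ, h) → (Lᵏ, g)`, where `n = m + k`, is a Smith submersion with respect to
the form `α` of degree `m = n - k`: `α ∧ u^* vol_L = (√k)⁻ᵏ |du|ᵏ vol_M` at every point. -/
structure IsSmithSubmersion (h : RiemMetric (m + k) M) (oM : ManifoldOrientation (m + k) M)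
    (g : RiemMetric k L) (oL : ManifoldOrientation k L) (α : SmoothForm (m + k) M m)
    (u : M → L) : Prop where
  smooth : ContMDiff (𝓡 (m + k)) (𝓡 k) ∞ u
  smith_eq : ∀ x : M,
    wedge (α.at_ x).toAlternatingMap
        ((riemVol g oL (u x)).compLinearMap (differential u x).toLinearMap) =
      (1 / √(k : ℝ) ^ k * normDu h g u x ^ k) • riemVol h oM x

end Smith

end SmithSubmersion

end

/-! The Smith equation says that `du` attains equality in a comass inequality. For a calibration
`α`, any linear map `A` from the tangent space of `M` to that of `L` satisfies |α ∧ A^* vol_L| ≤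
(|A|/√k)^k: in an orthonormal basis adapted to ker A the left side is a value of `α` on orthonormal
vectors times a k × k determinant, and Hadamard's inequality and AM-GM bound the determinant. The
map `A` is arbitrary in this inequality, so at `A = du` the first variation in every entry of `A`
vanishes. This is `rowWedge_update_of_comass_eq`.

In coordinates, let T^i_b be the coefficient, up to the factor m!, of α ∧ du¹ ∧ ⋯ ∧ du^k with du^b
replaced by dx^i. The vanishing first variation reads |du|^{k-2} h^{ij} ∂_j u^a g_{ab} = const ·
(√det g / √det h) T^i_b. Solving for the k-differential expresses |du|^{k-2} du through h, g(u) and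
T alone. The right side is differentiable even at zeros of du, which settles differentiability where
|du| itself need not be differentiable. The formula holds on a neighbourhood, so it may be
differentiated.

Two facts about T give the divergence. First, ∑ ∂_i T^i_b = 0, because up to sign and m! this sum is
the exterior derivative of α ∧ (the du^c with c ≠ b), which vanishes by dα = 0 and d(du^c) = 0
(`sum_pd_rowWedge_eq_zero`). Second, ∑ ∂_i u^c T^i_b = D δ_{bc}, because a repeated factor kills the
wedge product (`sum_row_mul_rowWedge_update`).

By `sum_inv_mul_matrixChristoffel`, the Levi-Civita terms of M turn Div into (√det h)⁻¹ ∂_i(√det h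
h^{ij} B_j), and that flux is a constant times √det g g^{ab}(u) T^i_b. Only the derivative of √det g
g^{ab} along u survives. Contracted with D δ_{bc} it gives the contracted Christoffel symbol of L,
which the connection term of u^*TL cancels (`divergence_eq_zero_of_coefficients`). -/

namespace SmithSubmersion

open Equiv Equiv.Perm

/-! ### Wedge coefficients as alternating functions of covectors, and their divergence -/

section RowWedge

variable {m k : ℕ}

/-- `m!` times the coefficient of `α ∧ β¹ ∧ ⋯ ∧ βᵏ`, an alternating function of the covectors
`β¹, …, βᵏ`. -/
noncomputable def rowWedge (α : EuclideanSpace ℝ (Fin (m + k)) [⋀^Fin m]→ₗ[ℝ] ℝ) :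
    (Fin (m + k) → ℝ) [⋀^Fin k]→ₗ[ℝ] ℝ :=
  { ∑ σ : Perm (Fin m ⊕ Fin k),
      (((sign σ : ℤ) : ℝ) * α fun i => EuclideanSpace.single (finSumFinEquiv (σ (Sum.inl i))) 1) •
      (MultilinearMap.mkPiAlgebra ℝ (Fin k) ℝ).compLinearMap
        (fun c => LinearMap.proj (finSumFinEquiv (σ (Sum.inr c)))) with
    map_eq_zero_of_eq' := by
      intro v i j hv hij
      simp only [MultilinearMap.toFun_eq_coe, sum_apply, smul_apply,
        MultilinearMap.compLinearMap_apply, MultilinearMap.mkPiAlgebra_apply, LinearMap.proj_apply,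
        smul_eq_mul]
      -- When rows i and j agree, the terms of σ and σ * (i j) have the same product and opposite
      -- signs.
      refine Finset.sum_involution (fun (σ : Perm (Fin m ⊕ Fin k)) _ => σ * swap (Sum.inr i) (Sum.inr j)) ?_ ?_
        (fun _ _ => Finset.mem_univ _) (fun σ _ => by simp [mul_assoc])
      · intro σ _
        have h1 : ∏ c, v c (finSumFinEquiv ((σ * swap (Sum.inr i) (Sum.inr j) : Perm (Fin m ⊕ Fin k)) (Sum.inr c))) =
            ∏ c, v c (finSumFinEquiv (σ (Sum.inr c))) := by
          rw [← Equiv.prod_comp (swap i j)]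
          refine Finset.prod_congr rfl fun c _ => ?_
          have h2 : v (swap i j c) = v c := by
            by_cases hi : c = i
            · subst hi; simp [hv]
            by_cases hj : c = j
            · subst hj; simp [hv]
            rw [swap_apply_of_ne_of_ne hi hj]
          have h3 : swap (Sum.inr i) (Sum.inr j) (Sum.inr (swap i j c) : Fin m ⊕ Fin k) =
              Sum.inr c := by
            by_cases hi : c = i
            · subst hi; simp
            by_cases hj : c = j
            · subst hj; simp
            rw [swap_apply_of_ne_of_ne hi hj, swap_apply_of_ne_of_ne] <;> simpa
          rw [h2, Perm.mul_apply, h3]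
        have h4 : (fun l => EuclideanSpace.single (finSumFinEquiv
              ((σ * swap (Sum.inr i) (Sum.inr j) : Perm (Fin m ⊕ Fin k)) (Sum.inl l))) (1 : ℝ)) =
            fun l => EuclideanSpace.single (finSumFinEquiv (σ (Sum.inl l))) 1 := by
          funext l
          rw [Perm.mul_apply, swap_apply_of_ne_of_ne] <;> simp
        rw [h1, h4, Perm.sign_mul, sign_swap (by simpa using hij)]
        push_cast
        ring
      · intro σ _ _ h
        have := congrArg (fun τ => σ⁻¹ * τ) h
        simp [hij] at this }

theorem rowWedge_apply (α : EuclideanSpace ℝ (Fin (m + k)) [⋀^Fin m]→ₗ[ℝ] ℝ)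
    (β : Fin k → Fin (m + k) → ℝ) :
    rowWedge α β = ∑ σ : Perm (Fin m ⊕ Fin k),
      ((sign σ : ℤ) : ℝ) * (α fun i => EuclideanSpace.single (finSumFinEquiv (σ (Sum.inl i))) 1) *
        ∏ c, β c (finSumFinEquiv (σ (Sum.inr c))) := by
  change (∑ σ : Perm (Fin m ⊕ Fin k), _ : MultilinearMap ℝ _ ℝ) β = _
  simp

/-- The pullback of the determinant is the alternatization of a product of k linear forms, and
alternatizing the already alternating `α` multiplies it by m!. Thus the shuffle sum, times m!,
becomes a sum over all permutations, which needs no choice of coset representatives. -/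
theorem factorial_mul_wedge (α : EuclideanSpace ℝ (Fin (m + k)) [⋀^Fin m]→ₗ[ℝ] ℝ)
    (A : EuclideanSpace ℝ (Fin (m + k)) →ₗ[ℝ] EuclideanSpace ℝ (Fin k)) :
    (m.factorial : ℝ) * wedge α ((EuclideanSpace.basisFun (Fin k) ℝ).toBasis.det.compLinearMap A)
      (fun i => EuclideanSpace.single i 1) =
    rowWedge α (fun c j => A (EuclideanSpace.single j 1) c) := by
  set b : MultilinearMap ℝ (fun _ : Fin k => EuclideanSpace ℝ (Fin (m + k))) ℝ :=
    (MultilinearMap.mkPiAlgebra ℝ (Fin k) ℝ).compLinearMap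
      (fun c => (EuclideanSpace.proj c : _ →L[ℝ] ℝ).toLinearMap ∘ₗ A) with hb
  have h1 : MultilinearMap.alternatization b =
      (EuclideanSpace.basisFun (Fin k) ℝ).toBasis.det.compLinearMap A := by
    ext v
    simp only [MultilinearMap.alternatization_apply, AlternatingMap.compLinearMap_apply,
      Module.Basis.det_apply, Matrix.det_apply]
    -- `Matrix.det_apply` permutes the coordinates and the alternatization permutes the vectors;
    -- inverting σ matches them.
    rw [← Equiv.sum_comp (Equiv.inv _)]
    refine Finset.sum_congr rfl fun σ _ => ?_
    simp only [Equiv.inv_apply, sign_inv]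
    congr 1
    simp only [hb, MultilinearMap.domDomCongr_apply, MultilinearMap.compLinearMap_apply,
      MultilinearMap.mkPiAlgebra_apply, Module.Basis.toMatrix_apply]
    rw [← Equiv.prod_comp σ]
    simp
  have h2 := MultilinearMap.domCoprod_alternization α.toMultilinearMap b
  rw [AlternatingMap.coe_alternatization, h1] at h2
  have h3 : (Nat.factorial (Fintype.card (Fin m)) • α).domCoprod
      ((EuclideanSpace.basisFun (Fin k) ℝ).toBasis.det.compLinearMap A) =
      Nat.factorial m • α.domCoprod
      ((EuclideanSpace.basisFun (Fin k) ℝ).toBasis.det.compLinearMap A) := by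
    rw [← AlternatingMap.domCoprod'_apply, ← AlternatingMap.domCoprod'_apply,
      ← TensorProduct.smul_tmul', map_nsmul, Fintype.card_fin]
  rw [h3] at h2
  have h4 := congrArg (fun f => LinearMap.mul' ℝ ℝ
    (f (fun i => EuclideanSpace.single (finSumFinEquiv i) 1))) h2
  simp only [AlternatingMap.smul_apply, map_nsmul, MultilinearMap.alternatization_apply, map_sum]
    at h4
  rw [rowWedge_apply]
  have h5 : wedge α ((EuclideanSpace.basisFun (Fin k) ℝ).toBasis.det.compLinearMap A)
      (fun i => EuclideanSpace.single i 1) = LinearMap.mul' ℝ ℝ (α.domCoprod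
      ((EuclideanSpace.basisFun (Fin k) ℝ).toBasis.det.compLinearMap A)
      (fun i => EuclideanSpace.single (finSumFinEquiv i) 1)) := rfl
  rw [h5, ← nsmul_eq_mul, ← h4]
  refine Finset.sum_congr rfl fun σ _ => ?_
  rcases Int.units_eq_one_or (sign σ) with hσ | hσ <;> simp [hσ, hb]

theorem rowWedge_update (α : EuclideanSpace ℝ (Fin (m + k)) [⋀^Fin m]→ₗ[ℝ] ℝ)
    (β : Fin k → Fin (m + k) → ℝ) (b : Fin k) (r : Fin (m + k) → ℝ) :
    rowWedge α (Function.update β b r) =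
      ∑ i, r i * rowWedge α (Function.update β b (Pi.single i 1)) := by
  conv_lhs => rw [pi_eq_sum_univ' r]
  rw [AlternatingMap.map_update_sum]
  exact Finset.sum_congr rfl fun i _ => by
    rw [AlternatingMap.map_update_smul, smul_eq_mul]

/-- Cofactor expansion: the sum puts row c in slot b, which either restores `β` or repeats a row. -/
theorem sum_row_mul_rowWedge_update (α : EuclideanSpace ℝ (Fin (m + k)) [⋀^Fin m]→ₗ[ℝ] ℝ)
    (β : Fin k → Fin (m + k) → ℝ) (b c : Fin k) :
    ∑ i, β c i * rowWedge α (Function.update β b (Pi.single i 1)) =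
      if b = c then rowWedge α β else 0 := by
  rw [← rowWedge_update]
  split_ifs with h
  · subst h; simp
  · exact AlternatingMap.map_update_self _ _ h

/-- The equation `dα = 0` in terms of replacing one entry. -/
theorem apply_eq_sum_update_of_alternatizeUncurryFin_eq_zero {V : Type*} [AddCommGroup V]
    [Module ℝ V] (a : V →ₗ[ℝ] V [⋀^Fin m]→ₗ[ℝ] ℝ)
    (ha : AlternatingMap.alternatizeUncurryFin a = 0) (w : V) (v : Fin m → V) :
    a w v = ∑ j, a (v j) (Function.update v j w) := by
  have h := congrArg (fun f => f (Fin.cons w v)) ha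
  simp only [AlternatingMap.alternatizeUncurryFin_apply, AlternatingMap.zero_apply] at h
  rw [Fin.sum_univ_succ] at h
  simp only [Fin.val_zero, pow_zero, Fin.cons_zero, one_smul, Fin.cons_succ, Fin.val_succ,
    Fin.removeNth_zero, Fin.tail_cons] at h
  rw [eq_neg_of_add_eq_zero_left h, ← Finset.sum_neg_distrib]
  refine Finset.sum_congr rfl fun j _ => ?_
  obtain ⟨p, rfl⟩ : ∃ p, m = p + 1 := ⟨m - 1, by have := j.2; omega⟩
  have h1 : j.succ.removeNth (Fin.cons w v : Fin (p + 1 + 1) → V) =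
      Matrix.vecCons w (j.removeNth v) := by
    funext q
    refine Fin.cases ?_ (fun q => ?_) q <;> simp [Fin.removeNth, Matrix.vecCons]
  rw [h1, ← Fin.insertNth_removeNth, AlternatingMap.map_insertNth, pow_succ]
  simp

/-- Up to sign and a factorial this is the coefficient of dα wedged with the rows other than b,
where `a` is the derivative of `α` as a linear map. Closedness trades the differentiated direction
for an argument of the form, which is a transposition of σ. -/
theorem sum_rowWedge_update_single_eq_zero
    (a : EuclideanSpace ℝ (Fin (m + k)) →ₗ[ℝ] EuclideanSpace ℝ (Fin (m + k)) [⋀^Fin m]→ₗ[ℝ] ℝ)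
    (ha : AlternatingMap.alternatizeUncurryFin a = 0) (β : Fin k → Fin (m + k) → ℝ) (b : Fin k) :
    ∑ i, rowWedge (a (EuclideanSpace.single i 1)) (Function.update β b (Pi.single i 1)) = 0 := by
  set e : Fin m ⊕ Fin k → EuclideanSpace ℝ (Fin (m + k)) :=
    fun s => EuclideanSpace.single (finSumFinEquiv s) 1 with he
  set F : Perm (Fin m ⊕ Fin k) → ℝ := fun σ => ((sign σ : ℤ) : ℝ) *
    a (e (σ (Sum.inr b))) (fun i => e (σ (Sum.inl i))) *
      ∏ c ∈ Finset.univ.erase b, β c (finSumFinEquiv (σ (Sum.inr c))) with hF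
  have h1 : ∑ i, rowWedge (a (EuclideanSpace.single i 1)) (Function.update β b (Pi.single i 1)) =
      ∑ σ, F σ := by
    simp only [rowWedge_apply]
    rw [Finset.sum_comm]
    refine Finset.sum_congr rfl fun σ _ => ?_
    -- Row b is a unit covector, so σ fixes the only index i that contributes.
    rw [Finset.sum_eq_single (finSumFinEquiv (σ (Sum.inr b)))]
    · rw [← Finset.mul_prod_erase _ _ (Finset.mem_univ b)]
      simp only [Function.update_self, Pi.single_eq_same, one_mul, hF, he]
      congr 1
      refine Finset.prod_congr rfl fun c hc => ?_
      rw [Function.update_of_ne (Finset.ne_of_mem_erase hc)]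
    · intro i _ hi
      rw [Finset.prod_eq_zero (Finset.mem_univ b), mul_zero]
      simp [Ne.symm hi]
    · simp
  have h2 : ∀ σ, F σ = ∑ j, -F (σ * swap (Sum.inl j) (Sum.inr b)) := by
    intro σ
    simp only [hF]
    rw [apply_eq_sum_update_of_alternatizeUncurryFin_eq_zero a ha, Finset.mul_sum,
      Finset.sum_mul]
    refine Finset.sum_congr rfl fun j _ => ?_
    have h3 : (fun i => e ((σ * swap (Sum.inl j) (Sum.inr b) : Perm (Fin m ⊕ Fin k))
        (Sum.inl i))) =
        Function.update (fun i => e (σ (Sum.inl i))) j (e (σ (Sum.inr b))) := by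
      funext i
      by_cases hi : i = j
      · subst hi; simp
      · rw [Function.update_of_ne hi, Perm.mul_apply, swap_apply_of_ne_of_ne] <;> simp [hi]
    have h4 : ∏ c ∈ Finset.univ.erase b, β c (finSumFinEquiv
          ((σ * swap (Sum.inl j) (Sum.inr b) : Perm (Fin m ⊕ Fin k)) (Sum.inr c))) =
        ∏ c ∈ Finset.univ.erase b, β c (finSumFinEquiv (σ (Sum.inr c))) :=
      Finset.prod_congr rfl fun c hc => by
        rw [Perm.mul_apply, swap_apply_of_ne_of_ne] <;> simp [Finset.ne_of_mem_erase hc]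
    rw [h3, h4, Perm.sign_mul, sign_swap (by simp), Perm.mul_apply, swap_apply_right]
    push_cast
    ring
  -- Right multiplication by a transposition permutes the group, so each of the m exchanges
  -- contributes the negative of the full sum; hence (1 + m) times that sum is zero.
  have h5 : ∑ σ, F σ = -(m * ∑ σ, F σ) := by
    conv_lhs => rw [Finset.sum_congr rfl fun σ _ => h2 σ]
    have h6 : ∀ j : Fin m, ∑ σ, -F (σ * swap (Sum.inl j) (Sum.inr b)) = -∑ σ, F σ := fun j => by
      rw [Finset.sum_neg_distrib]
      exact congrArg Neg.neg (Equiv.sum_comp (Equiv.mulRight (swap (Sum.inl j) (Sum.inr b))) F)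
    rw [Finset.sum_comm, Finset.sum_congr rfl fun j _ => h6 j]
    simp
  rw [h1]
  have hm : (0 : ℝ) ≤ m := m.cast_nonneg
  have h6 : (1 + (m : ℝ)) * ∑ σ, F σ = 0 := by linarith
  exact (mul_eq_zero.mp h6).resolve_left (by positivity)

theorem hasDerivAt_rowWedge {α : ℝ → EuclideanSpace ℝ (Fin (m + k)) [⋀^Fin m]→ₗ[ℝ] ℝ}
    {α' : EuclideanSpace ℝ (Fin (m + k)) [⋀^Fin m]→ₗ[ℝ] ℝ} {β : ℝ → Fin k → Fin (m + k) → ℝ}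
    {β' : Fin k → Fin (m + k) → ℝ} {t : ℝ} (hα : ∀ v, HasDerivAt (fun s => α s v) (α' v) t)
    (hβ : ∀ c j, HasDerivAt (fun s => β s c j) (β' c j) t) :
    HasDerivAt (fun s => rowWedge (α s) (β s))
      (rowWedge α' (β t) + ∑ c, rowWedge (α t) (Function.update (β t) c (β' c))) t := by
  have h1 : ∀ σ : Perm (Fin m ⊕ Fin k), HasDerivAt (fun s =>
      ((sign σ : ℤ) : ℝ) *
        (α s fun i => EuclideanSpace.single (finSumFinEquiv (σ (Sum.inl i))) 1) *
        ∏ c, β s c (finSumFinEquiv (σ (Sum.inr c)))) _ t := fun σ =>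
    ((hα _).const_mul _).mul (HasDerivAt.fun_finsetProd fun c _ =>
      hβ c (finSumFinEquiv (σ (Sum.inr c))))
  have h2 := HasDerivAt.fun_sum fun σ (_ : σ ∈ Finset.univ) => h1 σ
  simp only [rowWedge_apply]
  refine h2.congr_deriv ?_
  rw [Finset.sum_add_distrib, Finset.sum_comm (s := Finset.univ (α := Fin k))]
  congr 1
  refine Finset.sum_congr rfl fun σ _ => ?_
  rw [Finset.mul_sum]
  refine Finset.sum_congr rfl fun c _ => ?_
  rw [← Finset.mul_prod_erase _ (fun x => Function.update (β t) c (β' c) x _) (Finset.mem_univ c)]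
  rw [Function.update_self, smul_eq_mul, mul_comm (β' c _)]
  congr 2
  refine Finset.prod_congr rfl fun x hx => ?_
  rw [Function.update_of_ne (Finset.ne_of_mem_erase hx)]

theorem differentiableAt_rowWedge {X : Type*} [NormedAddCommGroup X] [NormedSpace ℝ X]
    {α : X → EuclideanSpace ℝ (Fin (m + k)) [⋀^Fin m]→ₗ[ℝ] ℝ}
    {β : X → Fin k → Fin (m + k) → ℝ} {x : X} (hα : ∀ v, DifferentiableAt ℝ (fun s => α s v) x)
    (hβ : ∀ c j, DifferentiableAt ℝ (fun s => β s c j) x) :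
    DifferentiableAt ℝ (fun s => rowWedge (α s) (β s)) x := by
  simp only [rowWedge_apply]
  exact DifferentiableAt.fun_sum fun σ _ =>
    ((hα _).const_mul _).mul (HasFDerivAt.finsetProd fun c _ => (hβ c _).hasFDerivAt).differentiableAt

theorem hasDerivAt_add_smul {n : ℕ} {f : EuclideanSpace ℝ (Fin n) → ℝ}
    {y : EuclideanSpace ℝ (Fin n)} (hf : DifferentiableAt ℝ f y) (i : Fin n) :
    HasDerivAt (fun t : ℝ => f (y + t • EuclideanSpace.single i 1)) (pd i f y) 0 :=
  hf.hasFDerivAt.hasLineDerivAt _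

theorem pd_pd_comm {n : ℕ} {f : EuclideanSpace ℝ (Fin n) → ℝ} {y : EuclideanSpace ℝ (Fin n)}
    (hf : ContDiffAt ℝ 2 f y) (i j : Fin n) :
    pd i (fun z => pd j f z) y = pd j (fun z => pd i f z) y := by
  have h1 := hf.isSymmSndFDerivAt (by simp)
  have h2 : DifferentiableAt ℝ (fderiv ℝ f) y :=
    (hf.fderiv_right (m := 1) (by norm_num)).differentiableAt (by norm_num)
  have h3 : ∀ i j, pd i (fun z => pd j f z) y =
      fderiv ℝ (fderiv ℝ f) y (EuclideanSpace.single i 1) (EuclideanSpace.single j 1) := by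
    intro i j
    simp only [pd]
    rw [fderiv_clm_apply h2 (differentiableAt_const _)]
    simp
  rw [h3, h3]
  exact h1 _ _

theorem differentiableAt_pd {n : ℕ} {f : EuclideanSpace ℝ (Fin n) → ℝ}
    {y : EuclideanSpace ℝ (Fin n)} (hf : ContDiffAt ℝ 2 f y) (j : Fin n) :
    DifferentiableAt ℝ (fun z => pd j f z) y :=
  ((hf.fderiv_right (m := 1) (by norm_num)).differentiableAt (by norm_num)).clm_apply
    (differentiableAt_const _)

/-- By the product rule, the derivative falls either on `α`, where dα = 0 applies, or on a row pd (f
c) with c ≠ b, where a symmetric Hessian is contracted with coefficients antisymmetric in slots b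
and c. -/
theorem sum_pd_rowWedge_eq_zero
    {α : EuclideanSpace ℝ (Fin (m + k)) → EuclideanSpace ℝ (Fin (m + k)) [⋀^Fin m]→L[ℝ] ℝ}
    {f : Fin k → EuclideanSpace ℝ (Fin (m + k)) → ℝ} {y : EuclideanSpace ℝ (Fin (m + k))}
    (hα : DifferentiableAt ℝ α y) (hdα : extDeriv α y = 0) (hf : ∀ c, ContDiffAt ℝ 2 (f c) y)
    (b : Fin k) :
    ∑ i, pd i (fun z => rowWedge (α z).toAlternatingMap
      (Function.update (fun c j => pd j (f c) z) b (Pi.single i 1))) y = 0 := by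
  set a : EuclideanSpace ℝ (Fin (m + k)) →ₗ[ℝ] EuclideanSpace ℝ (Fin (m + k)) [⋀^Fin m]→ₗ[ℝ] ℝ :=
    ContinuousAlternatingMap.toAlternatingMapLinear ∘ₗ (fderiv ℝ α y).toLinearMap with ha
  have ha0 : AlternatingMap.alternatizeUncurryFin a = 0 := by
    ext v
    have := congrArg (fun f => f v) hdα
    simp only [extDeriv, ContinuousAlternatingMap.alternatizeUncurryFin_apply] at this
    rw [AlternatingMap.alternatizeUncurryFin_apply]
    exact this
  have hαv : ∀ v, DifferentiableAt ℝ (fun z => α z v) y := fun v =>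
    (ContinuousAlternatingMap.apply ℝ (EuclideanSpace ℝ (Fin (m + k))) ℝ v).differentiableAt.comp
      y hα
  have hβ : ∀ (i : Fin (m + k)) (c : Fin k) (j : Fin (m + k)), DifferentiableAt ℝ (fun z =>
      Function.update (fun c j => pd j (f c) z) b (Pi.single i 1) c j) y := by
    intro i c j
    by_cases hc : c = b
    · subst hc; simp
    · simpa only [Function.update_of_ne hc] using differentiableAt_pd (hf c) j
  have h1 : ∀ i, pd i (fun z => rowWedge (α z).toAlternatingMap
      (Function.update (fun c j => pd j (f c) z) b (Pi.single i 1))) y =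
      rowWedge (a (EuclideanSpace.single i 1))
        (Function.update (fun c j => pd j (f c) y) b (Pi.single i 1)) +
      ∑ c, if c = b then 0 else rowWedge (α y).toAlternatingMap
        (Function.update (Function.update (fun c j => pd j (f c) y) b (Pi.single i 1)) c
          (fun j => pd i (fun z => pd j (f c) z) y)) := by
    intro i
    have hL := hasDerivAt_add_smul (differentiableAt_rowWedge
      (α := fun z => (α z).toAlternatingMap) hαv (hβ i)) i
    have hR := hasDerivAt_rowWedge
      (α := fun t : ℝ => (α (y + t • EuclideanSpace.single i 1)).toAlternatingMap) (t := 0)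
      (α' := a (EuclideanSpace.single i 1))
      (β := fun t => Function.update (fun c j => pd j (f c) (y + t • EuclideanSpace.single i 1)) b
        (Pi.single i 1))
      -- Row b is the constant dx^i, so its derivative is zero.
      (β' := fun c => if c = b then 0 else fun j => pd i (fun z => pd j (f c) z) y)
      (fun v => by
        refine (hasDerivAt_add_smul (hαv v) i).congr_deriv ?_
        simp only [pd]
        rw [fderiv_continuousAlternatingMap_apply_const_apply hα]
        rfl)
      (fun c j => by
        refine (hasDerivAt_add_smul (hβ i c j) i).congr_deriv ?_
        by_cases hc : c = b
        · subst hc; simp [pd]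
        · simp [hc])
    rw [hL.unique hR]
    simp only [zero_smul, add_zero]
    congr 1
    refine Finset.sum_congr rfl fun c _ => ?_
    split_ifs with hc
    · exact AlternatingMap.map_coord_zero _ c (by simp)
    · rfl
  rw [Finset.sum_congr rfl fun i _ => h1 i, Finset.sum_add_distrib,
    sum_rowWedge_update_single_eq_zero a ha0, zero_add, Finset.sum_comm]
  refine Finset.sum_eq_zero fun c _ => ?_
  by_cases hc : c = b
  · simp [hc]
  simp only [if_neg hc]
  set S : Fin (m + k) → Fin (m + k) → ℝ := fun i j => rowWedge (α y).toAlternatingMap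
    (Function.update (Function.update (fun c j => pd j (f c) y) b (Pi.single i 1)) c
      (Pi.single j 1)) with hS
  have hanti : ∀ i j, S j i = -S i j := by
    intro i j
    simp only [hS]
    rw [← AlternatingMap.map_swap _ _ hc]
    congr 1
    funext d
    by_cases hdc : d = c
    · subst hdc; simp [Function.update_of_ne (Ne.symm hc)]
    by_cases hdb : d = b
    · subst hdb; simp [Function.update_of_ne hdc]
    simp [Equiv.swap_apply_of_ne_of_ne hdc hdb, hdc, hdb]
  have h2 : ∑ i, rowWedge (α y).toAlternatingMap
        (Function.update (Function.update (fun c j => pd j (f c) y) b (Pi.single i 1)) c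
          (fun j => pd i (fun z => pd j (f c) z) y)) =
      ∑ i, ∑ j, pd i (fun z => pd j (f c) z) y * S i j :=
    Finset.sum_congr rfl fun i _ => rowWedge_update _ _ _ _
  have h3 : ∑ i, ∑ j, pd i (fun z => pd j (f c) z) y * S i j =
      -∑ i, ∑ j, pd i (fun z => pd j (f c) z) y * S i j := by
    conv_lhs => rw [Finset.sum_comm]
    simp only [← Finset.sum_neg_distrib]
    refine Finset.sum_congr rfl fun i _ => Finset.sum_congr rfl fun j _ => ?_
    rw [pd_pd_comm (hf c), hanti i j, mul_neg]
  rw [h2]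
  linarith

end RowWedge

/-! ### The comass inequality in orthonormal coordinates -/

section Comass

variable {V W : Type*} [AddCommGroup V] [Module ℝ V] [AddCommGroup W] [Module ℝ W] {m k : ℕ}

theorem wedge_compLinearMap (α : V [⋀^Fin m]→ₗ[ℝ] ℝ) (β : V [⋀^Fin k]→ₗ[ℝ] ℝ) (Q : W →ₗ[ℝ] V) :
    wedge (α.compLinearMap Q) (β.compLinearMap Q) = (wedge α β).compLinearMap Q := by
  have h : (α.compLinearMap Q).domCoprod (β.compLinearMap Q) =
      (α.domCoprod β).compLinearMap Q := by
    ext v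
    have h1 := congrArg (fun f => f v)
      (AlternatingMap.domCoprod_coe (α.compLinearMap Q) (β.compLinearMap Q))
    have h2 := congrArg (fun f => f (fun i => Q (v i))) (AlternatingMap.domCoprod_coe α β)
    simp only [sum_apply] at h1 h2
    refine h1.trans (Eq.trans ?_ h2.symm)
    refine Finset.sum_congr rfl fun σ _ => ?_
    induction σ using Quotient.inductionOn' with
    | h σ => rfl
  ext v
  exact congrArg (fun f => LinearMap.mul' ℝ ℝ (f (fun i => v (finSumFinEquiv i)))) h

theorem wedge_smul_right (α : V [⋀^Fin m]→ₗ[ℝ] ℝ) (c : ℝ) (β : V [⋀^Fin k]→ₗ[ℝ] ℝ) :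
    wedge α (c • β) = c • wedge α β := by
  have h : α.domCoprod (c • β) = c • α.domCoprod β := by
    rw [← AlternatingMap.domCoprod'_apply, ← AlternatingMap.domCoprod'_apply,
      TensorProduct.tmul_smul, map_smul]
  ext v
  simp only [wedge, h]
  exact map_smul (LinearMap.mul' ℝ ℝ) _ _

/-- If `β` vanishes as soon as one of its arguments is one of the first `m` vectors, then only one
shuffle contributes to `α ∧ β`. -/
theorem wedge_apply_of_annihilates (α : V [⋀^Fin m]→ₗ[ℝ] ℝ) (β : V [⋀^Fin k]→ₗ[ℝ] ℝ)
    (v : Fin m ⊕ Fin k → V)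
    (hβ : ∀ (w : Fin k → V) (c : Fin k) (i : Fin m), w c = v (Sum.inl i) → β w = 0) :
    wedge α β (fun i => v (finSumFinEquiv.symm i)) =
      α (fun i => v (Sum.inl i)) * β (fun i => v (Sum.inr i)) := by
  have h1 : wedge α β (fun i => v (finSumFinEquiv.symm i)) =
      LinearMap.mul' ℝ ℝ (α.domCoprod β v) := by
    refine congrArg (fun w => LinearMap.mul' ℝ ℝ (α.domCoprod β w)) (funext fun i => ?_)
    simp
  have h2 := congrArg (fun f => f v) (AlternatingMap.domCoprod_coe α β)
  simp only [sum_apply] at h2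
  have h3 : α.domCoprod β v = _ := h2
  rw [h1, h3]
  refine (congrArg _ (Finset.sum_eq_single (Quotient.mk'' 1) ?_ ?_)).trans ?_
  · intro q _ hq
    induction q using Quotient.inductionOn' with
    | h σ =>
      rw [AlternatingMap.domCoprod.summand_mk'']
      -- A permutation preserving the right block preserves both blocks and represents the trivial
      -- shuffle. Any other one feeds one of the first m vectors to `β`.
      have h4 : ∃ c i, σ (Sum.inr c) = Sum.inl i := by
        by_contra! hne
        apply hq
        have h5 : Set.MapsTo σ (Set.range Sum.inr) (Set.range Sum.inr) := by
          rintro _ ⟨c, rfl⟩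
          rcases hc : σ (Sum.inr c) with i | d
          · exact absurd hc (hne c i)
          · exact ⟨d, rfl⟩
        rw [← perm_mapsTo_inl_iff_mapsTo_inr] at h5
        refine Quotient.sound' ?_
        rw [QuotientGroup.leftRel_apply, mul_one]
        exact inv_mem (mem_sumCongrHom_range_of_perm_mapsTo_inl h5)
      obtain ⟨c, i, hci⟩ := h4
      have h6 : β (fun d => v (σ (Sum.inr d))) = 0 := hβ _ c i (by rw [hci])
      simp [h6]
  · simp
  · rw [AlternatingMap.domCoprod.summand_mk'']
    simp

/-- Both sides are the trace of A^*A. -/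
theorem sum_norm_sq_apply_orthonormalBasis {V W : Type*} [NormedAddCommGroup V]
    [InnerProductSpace ℝ V] [NormedAddCommGroup W] [InnerProductSpace ℝ W] [FiniteDimensional ℝ V]
    [FiniteDimensional ℝ W] {ι ι' : Type*} [Fintype ι] [Fintype ι'] (b : OrthonormalBasis ι ℝ V)
    (b' : OrthonormalBasis ι' ℝ V) (A : V →ₗ[ℝ] W) :
    ∑ i, ‖A (b i)‖ ^ 2 = ∑ i, ‖A (b' i)‖ ^ 2 := by
  have h : ∀ v, ‖A v‖ ^ 2 = inner ℝ v ((LinearMap.adjoint A ∘ₗ A) v) := fun v => by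
    rw [LinearMap.comp_apply, LinearMap.adjoint_inner_right, real_inner_self_eq_norm_sq]
  simp only [h]
  rw [← LinearMap.trace_eq_sum_inner _ b, ← LinearMap.trace_eq_sum_inner _ b']

/-- AM-GM for the squares; the factor √k in the Smith equation originates here. -/
theorem prod_le_sqrt_pow {k : ℕ} (hk : 0 < k) (z : Fin k → ℝ) (hz : ∀ i, 0 ≤ z i) :
    ∏ i, z i ≤ (√(∑ i, z i ^ 2) / √k) ^ k := by
  have hk' : (0 : ℝ) < k := by exact_mod_cast hk
  have h1 := Real.geom_mean_le_arith_mean_weighted Finset.univ (fun _ : Fin k => (k : ℝ)⁻¹)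
    (fun i => z i ^ 2) (fun _ _ => by positivity) (by simp [hk'.ne']) (fun _ _ => by positivity)
  rw [← Finset.mul_sum, Real.finsetProd_rpow _ _ (fun _ _ => by positivity)] at h1
  have h2 : ∏ i, z i ^ 2 ≤ ((k : ℝ)⁻¹ * ∑ i, z i ^ 2) ^ k := by
    refine le_trans (le_of_eq ?_) (pow_le_pow_left₀ (by positivity) h1 k)
    rw [Real.rpow_inv_natCast_pow (by positivity) hk.ne']
  rw [← Real.sqrt_div' _ hk'.le]
  refine (sq_le_sq₀ (Finset.prod_nonneg fun i _ => hz i) (by positivity)).mp ?_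
  rw [← pow_mul, mul_comm k 2, pow_mul, Real.sq_sqrt (by positivity), ← Finset.prod_pow]
  refine h2.trans (le_of_eq ?_)
  rw [inv_mul_eq_div]

/-- Hadamard's inequality, read off from the bound for the volume form of an oriented Euclidean
space. -/
theorem abs_det_le_prod_norm {k : ℕ} (v : Fin k → EuclideanSpace ℝ (Fin k)) :
    |(EuclideanSpace.basisFun (Fin k) ℝ).toBasis.det v| ≤ ∏ i, ‖v i‖ := by
  have : Fact (Module.finrank ℝ (EuclideanSpace ℝ (Fin k)) = k) := ⟨by simp⟩
  have h := (EuclideanSpace.basisFun (Fin k) ℝ).toBasis.orientation.abs_volumeForm_apply_le v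
  rwa [Orientation.volumeForm_robust _ _ rfl] at h

/-- The comass inequality for standard inner products. -/
theorem abs_wedge_le_of_comass (hk : 0 < k)
    (α : EuclideanSpace ℝ (Fin (m + k)) [⋀^Fin m]→ₗ[ℝ] ℝ)
    (hα : ∀ f : Fin m → EuclideanSpace ℝ (Fin (m + k)), Orthonormal ℝ f → |α f| ≤ 1)
    (A : EuclideanSpace ℝ (Fin (m + k)) →ₗ[ℝ] EuclideanSpace ℝ (Fin k)) :
    |wedge α ((EuclideanSpace.basisFun (Fin k) ℝ).toBasis.det.compLinearMap A)
        (fun i => EuclideanSpace.single i 1)| ≤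
      (√(∑ i, ‖A (EuclideanSpace.single i 1)‖ ^ 2) / √k) ^ k := by
  set D := (EuclideanSpace.basisFun (Fin k) ℝ).toBasis.det with hD
  set e := EuclideanSpace.basisFun (Fin (m + k)) ℝ with he
  have he1 : (fun i => EuclideanSpace.single i (1 : ℝ)) = e := by ext i; simp [he]
  by_cases hA : Function.Surjective A
  · have hker : Module.finrank ℝ (LinearMap.ker A) = m := by
      have := LinearMap.finrank_range_add_finrank_ker A
      rw [LinearMap.range_eq_top.mpr hA] at this
      simp at this
      omega
    set f : OrthonormalBasis (Fin m) ℝ (LinearMap.ker A) :=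
      (stdOrthonormalBasis ℝ (LinearMap.ker A)).reindex (finCongr hker) with hf
    -- The zeros on the right block are placeholders: the extension to an orthonormal basis keeps
    -- only the left block, a basis of ker A.
    set v : Fin m ⊕ Fin k → EuclideanSpace ℝ (Fin (m + k)) :=
      Sum.elim (fun i => (f i : EuclideanSpace ℝ (Fin (m + k)))) 0 with hv
    have hv1 : Orthonormal ℝ (fun i => (f i : EuclideanSpace ℝ (Fin (m + k)))) :=
      f.orthonormal.comp_linearIsometry (LinearMap.ker A).subtypeₗᵢ
    have hv2 : Orthonormal ℝ ((Set.range Sum.inl).domRestrict v) := by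
      have := hv1.comp (fun x : Set.range (Sum.inl : Fin m → Fin m ⊕ Fin k) =>
        (Equiv.ofInjective _ Sum.inl_injective).symm x) (Equiv.injective _)
      convert this using 1
      funext ⟨x, i, hi⟩
      subst hi
      simp [hv]
    obtain ⟨b, hb⟩ := hv2.exists_orthonormalBasis_extension_of_card_eq (by simp)
    have hb1 : ∀ i, b (Sum.inl i) = f i := fun i => by rw [hb _ ⟨i, rfl⟩]; rfl
    have hAb : ∀ i, A (b (Sum.inl i)) = 0 := fun i => by rw [hb1]; exact (f i).2
    set b' := b.reindex finSumFinEquiv with hb'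
    have h1 : wedge α (D.compLinearMap A) b' =
        α (fun i => b (Sum.inl i)) * D (fun i => A (b (Sum.inr i))) := by
      have := wedge_apply_of_annihilates α (D.compLinearMap A) b (fun w c i hw =>
        D.map_coord_zero c (by rw [hw, hAb]))
      exact Eq.trans (congrArg _ (funext fun i => by simp [hb'])) this
    -- A form of top degree takes values equal up to sign on two orthonormal bases.
    have h2 : |wedge α (D.compLinearMap A) e| = |wedge α (D.compLinearMap A) b'| := by
      have h3 := AlternatingMap.eq_smul_basis_det b'.toBasis (wedge α (D.compLinearMap A))
      have h4 := congrArg (fun f => |f e|) h3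
      simp only [AlternatingMap.smul_apply, smul_eq_mul, abs_mul] at h4
      rw [h4]
      rcases b'.det_to_matrix_orthonormalBasis_real e with h5 | h5 <;> rw [h5] <;> simp
    rw [he1, h2, h1, abs_mul]
    have h6 : |α fun i => b (Sum.inl i)| ≤ 1 := hα _ (b.orthonormal.comp _ Sum.inl_injective)
    have h7 := abs_det_le_prod_norm fun i => A (b (Sum.inr i))
    have h8 := prod_le_sqrt_pow hk (fun i => ‖A (b (Sum.inr i))‖) fun _ => norm_nonneg _
    have h9 : ∑ i, ‖A (b (Sum.inr i))‖ ^ 2 = ∑ i, ‖A (EuclideanSpace.single i 1)‖ ^ 2 := by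
      have := sum_norm_sq_apply_orthonormalBasis b e A
      rw [Fintype.sum_sum_type] at this
      simpa [hAb, he] using this
    rw [h9] at h8
    calc _ ≤ 1 * |D fun i => A (b (Sum.inr i))| := by gcongr
      _ ≤ _ := by rw [one_mul]; exact h7.trans h8
  -- Vectors with nonzero determinant form a basis, so a nonzero pullback would force `A` to be
  -- surjective.
  · have h0 : D.compLinearMap A = 0 := by
      ext v
      by_contra hne
      apply hA
      have h1 : IsUnit (D fun i => A (v i)) := isUnit_iff_ne_zero.mpr hne
      have h2 := (Module.Basis.is_basis_iff_det _).mpr h1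
      rw [← LinearMap.range_eq_top, eq_top_iff, ← h2.2, Submodule.span_le]
      rintro _ ⟨i, rfl⟩
      exact ⟨v i, rfl⟩
    have h1 : wedge α (D.compLinearMap A) = 0 := by
      have := wedge_smul_right α 0 (D.compLinearMap A)
      rwa [zero_smul, zero_smul, ← h0] at this
    rw [h1]
    simp only [AlternatingMap.zero_apply, abs_zero]
    positivity

end Comass

/-! ### The comass inequality for general metrics, and its first variation at equality -/

section Energy

variable {m k n : ℕ}

/-- The polarization of `|A|² = h^{ij} A_iᵃ A_jᵇ g_{ab}`. -/
noncomputable def energy (H : Matrix (Fin n) (Fin n) ℝ) (G : Matrix (Fin k) (Fin k) ℝ)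
    (β γ : Fin k → Fin n → ℝ) : ℝ :=
  ∑ i, ∑ j, H⁻¹ i j * ∑ a, ∑ b, β a i * G a b * γ b j

theorem energy_comm {H : Matrix (Fin n) (Fin n) ℝ} {G : Matrix (Fin k) (Fin k) ℝ}
    (hH : H.IsHermitian) (hG : G.IsHermitian) (β γ : Fin k → Fin n → ℝ) :
    energy H G β γ = energy H G γ β := by
  have hH' : ∀ i j, H⁻¹ i j = H⁻¹ j i := fun i j => by simpa using (hH.inv.apply j i)
  have hG' : ∀ i j, G i j = G j i := fun i j => by simpa using (hG.apply j i)
  unfold energy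
  rw [Finset.sum_comm]
  refine Finset.sum_congr rfl fun i _ => Finset.sum_congr rfl fun j _ => ?_
  rw [hH' j i]
  congr 1
  rw [Finset.sum_comm]
  refine Finset.sum_congr rfl fun a _ => Finset.sum_congr rfl fun b _ => ?_
  rw [hG' b a]
  ring

theorem energy_add_smul {H : Matrix (Fin n) (Fin n) ℝ} {G : Matrix (Fin k) (Fin k) ℝ}
    (hH : H.IsHermitian) (hG : G.IsHermitian) (β γ : Fin k → Fin n → ℝ) (t : ℝ) :
    energy H G (β + t • γ) (β + t • γ) =
      energy H G β β + 2 * t * energy H G β γ + t ^ 2 * energy H G γ γ := by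
  have h : energy H G (β + t • γ) (β + t • γ) = energy H G β β + t * energy H G β γ +
      t * energy H G γ β + t ^ 2 * energy H G γ γ := by
    unfold energy
    simp only [Finset.mul_sum, ← Finset.sum_add_distrib]
    refine Finset.sum_congr rfl fun i _ => Finset.sum_congr rfl fun j _ =>
      Finset.sum_congr rfl fun a _ => Finset.sum_congr rfl fun b _ => ?_
    simp only [Pi.add_apply, Pi.smul_apply, smul_eq_mul]
    ring
  rw [h, energy_comm hH hG γ β]
  ring

theorem energy_single (H : Matrix (Fin n) (Fin n) ℝ) (G : Matrix (Fin k) (Fin k) ℝ)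
    (β : Fin k → Fin n → ℝ) (b : Fin k) (i : Fin n) :
    energy H G β (Pi.single b (Pi.single i 1)) = ∑ j, ∑ a, H⁻¹ j i * β a j * G a b := by
  unfold energy
  refine Finset.sum_congr rfl fun j _ => ?_
  rw [Finset.sum_eq_single i]
  · rw [Finset.mul_sum]
    refine Finset.sum_congr rfl fun a _ => ?_
    rw [Finset.sum_eq_single b]
    · simp; ring
    · intro c _ hc; simp [Pi.single_eq_of_ne hc]
    · simp
  · intro l _ hl
    rw [Finset.sum_eq_zero, mul_zero]
    intro a _
    refine Finset.sum_eq_zero fun c _ => ?_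
    by_cases hc : c = b
    · subst hc; simp [Pi.single_eq_of_ne hl]
    · simp [Pi.single_eq_of_ne hc]
  · simp

-- `R` passes to orthonormal coordinates, and |det R| is the volume density.
open scoped MatrixOrder in
theorem exists_eq_transpose_mul_self {H : Matrix (Fin n) (Fin n) ℝ} (hH : H.PosDef) :
    ∃ R : Matrix (Fin n) (Fin n) ℝ, H = R.transpose * R ∧ IsUnit R.det ∧ |R.det| = √H.det := by
  obtain ⟨R, hR⟩ := CStarAlgebra.nonneg_iff_eq_star_mul_self.mp hH.posSemidef.nonneg
  rw [Matrix.star_eq_conjTranspose, Matrix.conjTranspose_eq_transpose_of_trivial] at hR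
  have h1 : H.det = R.det ^ 2 := by rw [hR, Matrix.det_mul, Matrix.det_transpose, sq]
  refine ⟨R, hR, ?_, by rw [h1, Real.sqrt_sq_eq_abs]⟩
  rw [isUnit_iff_ne_zero]
  intro h0
  have := hH.det_pos
  rw [h1, h0] at this
  simp at this

/-- In orthonormal coordinates for both metrics the map β becomes S β R⁻¹, and its energy becomes a
Hilbert–Schmidt norm. Positivity, definiteness and the comass inequality all reduce to this form. -/
theorem energy_eq_sum_norm_sq (R : Matrix (Fin n) (Fin n) ℝ) (S : Matrix (Fin k) (Fin k) ℝ)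
    (β : Fin k → Fin n → ℝ) :
    energy (R.transpose * R) (S.transpose * S) β β =
      ∑ i, ‖(S * Matrix.of β * R⁻¹).toEuclideanLin (EuclideanSpace.single i 1)‖ ^ 2 := by
  have h1 : ∀ i, ‖(S * Matrix.of β * R⁻¹).toEuclideanLin (EuclideanSpace.single i 1)‖ ^ 2 =
      ((S * Matrix.of β * R⁻¹).transpose * (S * Matrix.of β * R⁻¹)) i i := by
    intro i
    rw [EuclideanSpace.norm_sq_eq, Matrix.mul_apply]
    refine Finset.sum_congr rfl fun a _ => ?_
    simp [Matrix.toLpLin_apply, sq]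
    rfl
  have h2 : energy (R.transpose * R) (S.transpose * S) β β =
      ((R.transpose * R)⁻¹ * ((Matrix.of β).transpose * (S.transpose * S) * Matrix.of β)).trace := by
    set M := (Matrix.of β).transpose * (S.transpose * S) * Matrix.of β with hM
    have hMt : M.transpose = M := by
      simp [hM, Matrix.transpose_mul, Matrix.mul_assoc]
    unfold energy
    rw [Matrix.trace]
    refine Finset.sum_congr rfl fun i _ => ?_
    rw [Matrix.diag_apply, Matrix.mul_apply]
    refine Finset.sum_congr rfl fun j _ => ?_
    congr 1
    rw [← Matrix.transpose_apply M, hMt, hM, Matrix.mul_apply, Finset.sum_comm]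
    refine Finset.sum_congr rfl fun b _ => ?_
    rw [Matrix.mul_apply, Finset.sum_mul]
    rfl
  rw [h2, Finset.sum_congr rfl fun i _ => h1 i]
  change _ = Matrix.trace _
  rw [Matrix.mul_inv_rev, Matrix.mul_assoc, Matrix.trace_mul_comm]
  simp only [Matrix.transpose_mul, Matrix.mul_assoc, Matrix.transpose_nonsing_inv]

theorem energy_nonneg {H : Matrix (Fin n) (Fin n) ℝ} {G : Matrix (Fin k) (Fin k) ℝ}
    (hH : H.PosDef) (hG : G.PosDef) (β : Fin k → Fin n → ℝ) : 0 ≤ energy H G β β := by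
  obtain ⟨R, rfl, -, -⟩ := exists_eq_transpose_mul_self hH
  obtain ⟨S, rfl, -, -⟩ := exists_eq_transpose_mul_self hG
  rw [energy_eq_sum_norm_sq]
  positivity

theorem eq_zero_of_energy_eq_zero {H : Matrix (Fin n) (Fin n) ℝ} {G : Matrix (Fin k) (Fin k) ℝ}
    (hH : H.PosDef) (hG : G.PosDef) (β : Fin k → Fin n → ℝ) (h : energy H G β β = 0) : β = 0 := by
  obtain ⟨R, rfl, hR, -⟩ := exists_eq_transpose_mul_self hH
  obtain ⟨S, rfl, hS, -⟩ := exists_eq_transpose_mul_self hG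
  rw [energy_eq_sum_norm_sq, Finset.sum_eq_zero_iff_of_nonneg fun _ _ => by positivity] at h
  have h1 : S * Matrix.of β * R⁻¹ = 0 := by
    rw [← Matrix.toEuclideanLin.map_eq_zero_iff]
    refine (EuclideanSpace.basisFun (Fin n) ℝ).toBasis.ext fun i => ?_
    simpa using h i (Finset.mem_univ i)
  have h2 : S⁻¹ * (S * Matrix.of β * R⁻¹) * R = Matrix.of β := by
    rw [Matrix.mul_assoc, Matrix.nonsing_inv_mul_cancel_right _ _ hR,
      Matrix.nonsing_inv_mul_cancel_left _ _ hS]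
  rw [h1, Matrix.mul_zero, Matrix.zero_mul] at h2
  exact h2.symm

/-- The comass inequality for the inner products with matrices `H` and `G`. -/
theorem abs_rowWedge_le_of_comass (hk : 0 < k) {H : Matrix (Fin (m + k)) (Fin (m + k)) ℝ}
    {G : Matrix (Fin k) (Fin k) ℝ} (hH : H.PosDef) (hG : G.PosDef)
    (α : EuclideanSpace ℝ (Fin (m + k)) [⋀^Fin m]→ₗ[ℝ] ℝ)
    (hα : ∀ v, |α v| ≤ √(gram (fun x y : EuclideanSpace ℝ (Fin (m + k)) =>
      ∑ p, ∑ q, x p * H p q * y q) v).det) (β : Fin k → Fin (m + k) → ℝ) :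
    √G.det * |rowWedge α β| ≤
      m.factorial * √H.det * (√(energy H G β β) / √k) ^ k := by
  obtain ⟨R, rfl, hR, hRd⟩ := exists_eq_transpose_mul_self hH
  obtain ⟨S, rfl, hS, hSd⟩ := exists_eq_transpose_mul_self hG
  set D := (EuclideanSpace.basisFun (Fin k) ℝ).toBasis.det with hD
  set A : EuclideanSpace ℝ (Fin (m + k)) →ₗ[ℝ] EuclideanSpace ℝ (Fin k) :=
    Matrix.toEuclideanLin (Matrix.of β) with hA
  set Q : EuclideanSpace ℝ (Fin (m + k)) →ₗ[ℝ] EuclideanSpace ℝ (Fin (m + k)) :=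
    Matrix.toEuclideanLin R⁻¹ with hQ
  set A' : EuclideanSpace ℝ (Fin (m + k)) →ₗ[ℝ] EuclideanSpace ℝ (Fin k) :=
    Matrix.toEuclideanLin (S * Matrix.of β * R⁻¹) with hA'
  have hcomass := abs_wedge_le_of_comass hk (α.compLinearMap Q) (fun f hf => by
    refine (hα _).trans (le_of_eq ?_)
    have h1 : gram (fun x y : EuclideanSpace ℝ (Fin (m + k)) =>
        ∑ p, ∑ q, x p * (R.transpose * R) p q * y q) (fun i => Q (f i)) = 1 := by
      ext i j
      have h2 : inner ℝ (f i) (f j) = (1 : Matrix (Fin m) (Fin m) ℝ) i j := by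
        rw [Matrix.one_apply]; exact (orthonormal_iff_ite.mp hf) i j
      rw [← h2]
      have h3 : ∀ x y : EuclideanSpace ℝ (Fin (m + k)),
          ∑ p, ∑ q, x p * (R.transpose * R) p q * y q =
          (R.mulVec x.ofLp) ⬝ᵥ (R.mulVec y.ofLp) := by
        intro x y
        have h4 : ∑ p, ∑ q, x.ofLp p * (R.transpose * R) p q * y.ofLp q =
            x.ofLp ⬝ᵥ (R.transpose * R).mulVec y.ofLp := by
          simp only [dotProduct, Matrix.mulVec, Finset.mul_sum, mul_assoc]
        rw [h4, ← Matrix.mulVec_mulVec, Matrix.dotProduct_mulVec, Matrix.vecMul_transpose]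
      have h5 : ∀ x, R.mulVec (Q x).ofLp = x.ofLp := fun x => by
        simp [hQ, Matrix.toLpLin_apply, Matrix.mul_nonsing_inv _ hR]
      refine (h3 (Q (f i)) (Q (f j))).trans ?_
      rw [h5, h5]
      simp [PiLp.inner_apply, dotProduct, mul_comm]
    simp [h1]) A'
  have hdetlin : ∀ {d : ℕ} (N : Matrix (Fin d) (Fin d) ℝ),
      (EuclideanSpace.basisFun (Fin d) ℝ).toBasis.det.compLinearMap (Matrix.toEuclideanLin N) =
      N.det • (EuclideanSpace.basisFun (Fin d) ℝ).toBasis.det := by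
    intro d N
    ext v
    have h1 := Module.Basis.det_comp (EuclideanSpace.basisFun (Fin d) ℝ).toBasis
      (Matrix.toEuclideanLin N) v
    rw [Matrix.toEuclideanLin_eq_toLin_orthonormal, LinearMap.det_toLin] at h1
    rw [Matrix.toEuclideanLin_eq_toLin_orthonormal]
    exact h1
  have hAA : A' = Matrix.toEuclideanLin S ∘ₗ A ∘ₗ Q := by
    ext i c
    simp [hA', hA, hQ, Matrix.toLpLin_apply, Matrix.mulVec_mulVec, Matrix.mul_assoc]
  set e := (EuclideanSpace.basisFun (Fin (m + k)) ℝ).toBasis with he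
  have he1 : (fun i => EuclideanSpace.single i (1 : ℝ)) = e := by ext i; simp [he]
  -- The change of coordinates on the target contributes det S and the one on the source (det R)⁻¹,
  -- which become the two volume densities.
  have hw : wedge (α.compLinearMap Q) (D.compLinearMap A') =
      (S.det * (wedge α (D.compLinearMap A) e * R⁻¹.det)) • e.det := by
    have h1 : D.compLinearMap A' = (S.det • D.compLinearMap A).compLinearMap Q := by
      have h2 := congrArg (fun f => f.compLinearMap (A ∘ₗ Q)) (hdetlin S)
      rw [hAA]
      exact h2
    rw [h1, wedge_compLinearMap, wedge_smul_right,
      AlternatingMap.eq_smul_basis_det e (wedge α (D.compLinearMap A))]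
    have h3 := hdetlin R⁻¹
    ext v
    have h4 := congrArg (fun f => f v) h3
    simp only [AlternatingMap.compLinearMap_apply, AlternatingMap.smul_apply, smul_eq_mul] at h4 ⊢
    rw [h4, Module.Basis.det_self]
    ring
  rw [hw, he1, AlternatingMap.smul_apply, Module.Basis.det_self, smul_eq_mul, mul_one, abs_mul,
    abs_mul, hSd, Matrix.det_nonsing_inv, Ring.inverse_eq_inv', abs_inv, hRd] at hcomass
  have hH0 : 0 < √(R.transpose * R).det := Real.sqrt_pos.mpr hH.det_pos
  have hf := factorial_mul_wedge α A
  have hβ : (fun c j => A (EuclideanSpace.single j 1) c) = β := by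
    funext c j
    simp [hA, Matrix.toLpLin_apply]
  rw [hβ, he1] at hf
  rw [← hf, energy_eq_sum_norm_sq, abs_mul, Nat.abs_cast]
  have h7 := mul_le_mul_of_nonneg_left hcomass
    (by positivity : 0 ≤ (m.factorial : ℝ) * √(R.transpose * R).det)
  refine le_trans (le_of_eq ?_) h7
  rw [← hD]
  field_simp

/-- At a maximum of the comass inequality the first variation vanishes. -/
theorem rowWedge_update_of_comass_eq (hk : 2 ≤ k) {H : Matrix (Fin (m + k)) (Fin (m + k)) ℝ}
    {G : Matrix (Fin k) (Fin k) ℝ} (hH : H.PosDef) (hG : G.PosDef)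
    (α : EuclideanSpace ℝ (Fin (m + k)) [⋀^Fin m]→ₗ[ℝ] ℝ)
    (hα : ∀ v, |α v| ≤ √(gram (fun x y : EuclideanSpace ℝ (Fin (m + k)) =>
      ∑ p, ∑ q, x p * H p q * y q) v).det) (β : Fin k → Fin (m + k) → ℝ) {s : ℝ} (hs : |s| = 1)
    (heq : s * √G.det * rowWedge α β = m.factorial * √H.det * (√(energy H G β β) / √k) ^ k)
    (b : Fin k) (i : Fin (m + k)) :
    s * √G.det * rowWedge α (Function.update β b (Pi.single i 1)) =
      m.factorial * √H.det * (k / √k ^ k) * √(energy H G β β) ^ (k - 2) *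
        ∑ j, ∑ a, H⁻¹ j i * β a j * G a b := by
  rw [← energy_single]
  set γ : Fin k → Fin (m + k) → ℝ := Pi.single b (Pi.single i 1) with hγ
  -- Where β = 0 the square root is not differentiable, but k ≥ 2 leaves a zero row beside row b, so
  -- both sides vanish.
  rcases (energy_nonneg hH hG β).eq_or_lt with h0 | hpos
  · have hβ := eq_zero_of_energy_eq_zero hH hG β h0.symm
    obtain ⟨c, hc⟩ : ∃ c : Fin k, c ≠ b := by
      have : Nontrivial (Fin k) := Fin.nontrivial_iff_two_le.mpr hk
      exact exists_ne b
    have h1 : energy H G β γ = 0 := by simp [energy, hβ]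
    rw [h1, AlternatingMap.map_coord_zero _ c (by rw [Function.update_of_ne hc, hβ]; rfl)]
    simp
  set C : ℝ := m.factorial * √H.det * (1 / √k ^ k) with hC
  -- The gap in the comass inequality when entry (b, i) is moved by t. It is nonnegative and
  -- vanishes at t = 0, so its derivative there is zero; the wedge term is affine in t because only
  -- one row moves.
  set φ : ℝ → ℝ := fun t => C * √(energy H G β β + 2 * t * energy H G β γ +
    t ^ 2 * energy H G γ γ) ^ k - (s * √G.det) * (rowWedge α β +
      t * rowWedge α (Function.update β b (Pi.single i 1))) with hφ
  have hφ0 : φ 0 = 0 := by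
    simp only [hφ, hC]
    rw [div_pow] at heq
    simp only [mul_zero, zero_mul, add_zero, ne_eq, OfNat.ofNat_ne_zero, not_false_eq_true,
      zero_pow]
    rw [heq]
    ring
  have hφnn : ∀ t, 0 ≤ φ t := by
    intro t
    have h1 : rowWedge α (β + t • γ) = rowWedge α β +
        t * rowWedge α (Function.update β b (Pi.single i 1)) := by
      have h2 : β + t • γ = Function.update β b (β b + t • Pi.single i 1) := by
        funext c
        by_cases hc : c = b
        · subst hc; simp [hγ]
        · simp [hγ, hc]
      rw [h2, AlternatingMap.map_update_add, AlternatingMap.map_update_smul,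
        Function.update_eq_self, smul_eq_mul]
    have h3 := abs_rowWedge_le_of_comass (by omega) hH hG α hα (β + t • γ)
    rw [energy_add_smul hH.1 hG.1, h1, div_pow] at h3
    simp only [hφ, hC]
    have h4 : (s * √G.det) * (rowWedge α β +
        t * rowWedge α (Function.update β b (Pi.single i 1))) ≤ √G.det * |rowWedge α β +
        t * rowWedge α (Function.update β b (Pi.single i 1))| := by
      refine (le_abs_self _).trans (le_of_eq ?_)
      rw [abs_mul, abs_mul, hs, one_mul, abs_of_nonneg (Real.sqrt_nonneg _)]
    refine sub_nonneg.mpr (h4.trans (h3.trans (le_of_eq ?_)))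
    ring
  have hmin : IsLocalMin φ 0 := Filter.Eventually.of_forall fun t => by rw [hφ0]; exact hφnn t
  have hd1 : HasDerivAt (fun t : ℝ => energy H G β β + 2 * t * energy H G β γ +
      t ^ 2 * energy H G γ γ) (2 * energy H G β γ) 0 := by
    have h1 : HasDerivAt (fun t : ℝ => 2 * t * energy H G β γ) (2 * energy H G β γ) 0 := by
      simpa using ((hasDerivAt_id (0 : ℝ)).const_mul 2).mul_const (energy H G β γ)
    have h2 : HasDerivAt (fun t : ℝ => t ^ 2 * energy H G γ γ) 0 0 := by
      simpa using (hasDerivAt_pow 2 (0 : ℝ)).mul_const (energy H G γ γ)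
    simpa using (h1.const_add (energy H G β β)).fun_add h2
  have hd2 := (hd1.sqrt (by simpa using hpos.ne')).pow k
  have hd3 : HasDerivAt (fun t : ℝ => (s * √G.det) * (rowWedge α β +
      t * rowWedge α (Function.update β b (Pi.single i 1))))
      ((s * √G.det) * rowWedge α (Function.update β b (Pi.single i 1))) 0 := by
    have := (hasDerivAt_id (0 : ℝ)).mul_const (rowWedge α (Function.update β b (Pi.single i 1)))
    simpa using (this.const_add (rowWedge α β)).const_mul (s * √G.det)
  have hd := hmin.hasDerivAt_eq_zero ((hd2.const_mul C).sub hd3)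
  rw [← sub_eq_zero.mp hd]
  simp only [mul_zero, zero_mul, add_zero, ne_eq, OfNat.ofNat_ne_zero, not_false_eq_true,
      zero_pow]
  have hsq : 0 < √(energy H G β β) := Real.sqrt_pos.mpr hpos
  obtain ⟨l, rfl⟩ : ∃ l, k = l + 2 := ⟨k - 2, by omega⟩
  simp only [hC, Nat.add_sub_cancel, show l + 2 - 1 = l + 1 by omega, pow_succ]
  field_simp

end Energy

/-! ### Derivatives of determinants and inverses, Christoffel symbols, and the divergence in
coordinates -/

section Calculus

variable {n k : ℕ}

theorem pd_mul {f g : EuclideanSpace ℝ (Fin n) → ℝ} {y : EuclideanSpace ℝ (Fin n)}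
    (hf : DifferentiableAt ℝ f y) (hg : DifferentiableAt ℝ g y) (i : Fin n) :
    pd i (fun z => f z * g z) y = pd i f y * g y + f y * pd i g y := by
  simp only [pd]
  rw [fderiv_fun_mul hf hg]
  simp
  ring

theorem pd_sum {ι : Type*} {s : Finset ι} {f : ι → EuclideanSpace ℝ (Fin n) → ℝ}
    {y : EuclideanSpace ℝ (Fin n)} (hf : ∀ j ∈ s, DifferentiableAt ℝ (f j) y) (i : Fin n) :
    pd i (fun z => ∑ j ∈ s, f j z) y = ∑ j ∈ s, pd i (f j) y := by
  simp only [pd]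
  rw [fderiv_fun_sum hf]
  simp

theorem pd_const_mul {f : EuclideanSpace ℝ (Fin n) → ℝ} {y : EuclideanSpace ℝ (Fin n)}
    (hf : DifferentiableAt ℝ f y) (c : ℝ) (i : Fin n) :
    pd i (fun z => c * f z) y = c * pd i f y := by
  simp only [pd]
  rw [fderiv_const_mul hf]
  simp

theorem pd_congr {f g : EuclideanSpace ℝ (Fin n) → ℝ} {y : EuclideanSpace ℝ (Fin n)}
    (h : f =ᶠ[𝓝 y] g) (i : Fin n) : pd i f y = pd i g y := by
  simp only [pd]
  rw [h.fderiv_eq]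

theorem pd_comp {u : EuclideanSpace ℝ (Fin n) → EuclideanSpace ℝ (Fin k)}
    {f : EuclideanSpace ℝ (Fin k) → ℝ} {y : EuclideanSpace ℝ (Fin n)}
    (hu : DifferentiableAt ℝ u y) (hf : DifferentiableAt ℝ f (u y)) (i : Fin n) :
    pd i (fun z => f (u z)) y = ∑ c, pd c f (u y) * pd i (fun z => u z c) y := by
  have h1 : ∀ c, pd i (fun z => u z c) y = fderiv ℝ u y (EuclideanSpace.single i 1) c := by
    intro c
    have := ((EuclideanSpace.proj c : EuclideanSpace ℝ (Fin k) →L[ℝ] ℝ).hasFDerivAt.comp y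
      hu.hasFDerivAt).fderiv
    exact congrArg (fun L => L (EuclideanSpace.single i 1)) this
  have h2 : pd i (fun z => f (u z)) y =
      fderiv ℝ f (u y) (fderiv ℝ u y (EuclideanSpace.single i 1)) :=
    congrArg (fun L => L (EuclideanSpace.single i 1)) (fderiv_comp y hf hu)
  rw [h2]
  conv_lhs => rw [← (EuclideanSpace.basisFun (Fin k) ℝ).sum_repr
    (fderiv ℝ u y (EuclideanSpace.single i 1)), map_sum]
  refine Finset.sum_congr rfl fun c _ => ?_
  rw [map_smul, smul_eq_mul, h1, mul_comm]
  simp [pd]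

theorem differentiableAt_det {X : Type*} [NormedAddCommGroup X] [NormedSpace ℝ X]
    {H : X → Matrix (Fin n) (Fin n) ℝ} {x : X}
    (hH : ∀ i j, DifferentiableAt ℝ (fun z => H z i j) x) :
    DifferentiableAt ℝ (fun z => (H z).det) x := by
  simp only [Matrix.det_apply']
  exact DifferentiableAt.fun_sum fun σ _ => DifferentiableAt.const_mul
    (HasFDerivAt.finsetProd fun c _ => (hH _ c).hasFDerivAt).differentiableAt _

theorem hasDerivAt_det {H : ℝ → Matrix (Fin n) (Fin n) ℝ} {H' : Matrix (Fin n) (Fin n) ℝ} {t : ℝ}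
    (hH : ∀ i j, HasDerivAt (fun s => H s i j) (H' i j) t) :
    HasDerivAt (fun s => (H s).det) (∑ i, ((H t).updateCol i (fun j => H' j i)).det) t := by
  have h1 : ∀ σ : Equiv.Perm (Fin n), HasDerivAt (fun s =>
      ((Equiv.Perm.sign σ : ℤ) : ℝ) * ∏ c, H s (σ c) c) _ t := fun σ =>
    (HasDerivAt.fun_finsetProd fun c _ => hH (σ c) c).const_mul _
  have h2 := HasDerivAt.fun_sum fun σ (_ : σ ∈ Finset.univ) => h1 σ
  simp only [Matrix.det_apply']
  refine h2.congr_deriv ?_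
  rw [Finset.sum_comm]
  refine Finset.sum_congr rfl fun σ _ => ?_
  rw [Finset.mul_sum]
  refine Finset.sum_congr rfl fun c _ => ?_
  rw [← Finset.mul_prod_erase _ (fun x => (H t).updateCol c _ (σ x) x) (Finset.mem_univ c)]
  rw [Matrix.updateCol_self, smul_eq_mul, mul_comm (H' _ c)]
  congr 2
  refine Finset.prod_congr rfl fun x hx => ?_
  rw [Matrix.updateCol_ne (Finset.ne_of_mem_erase hx)]

/-- Jacobi's formula. -/
theorem pd_det {H : EuclideanSpace ℝ (Fin n) → Matrix (Fin k) (Fin k) ℝ}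
    {y : EuclideanSpace ℝ (Fin n)} (hH : ∀ i j, DifferentiableAt ℝ (fun z => H z i j) y)
    (h0 : IsUnit (H y).det) (r : Fin n) :
    pd r (fun z => (H z).det) y =
      (H y).det * ∑ i, ∑ j, (H y)⁻¹ i j * pd r (fun z => H z j i) y := by
  have hL := hasDerivAt_add_smul (differentiableAt_det hH) r
  have hR := hasDerivAt_det (H := fun t : ℝ => H (y + t • EuclideanSpace.single r 1))
    (H' := fun i j => pd r (fun z => H z i j) y) (t := 0)
    (fun i j => hasDerivAt_add_smul (hH i j) r)
  rw [hL.unique hR, Finset.mul_sum]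
  simp only [zero_smul, add_zero]
  refine Finset.sum_congr rfl fun i _ => ?_
  rw [← Matrix.cramer_apply, Matrix.cramer_eq_adjugate_mulVec, Matrix.mulVec, dotProduct,
    Finset.mul_sum]
  refine Finset.sum_congr rfl fun j _ => ?_
  rw [Matrix.inv_def, Matrix.smul_apply, smul_eq_mul, ← mul_assoc, ← mul_assoc,
    Ring.mul_inverse_cancel _ h0, one_mul]

theorem differentiableAt_inv_apply {X : Type*} [NormedAddCommGroup X] [NormedSpace ℝ X]
    {H : X → Matrix (Fin n) (Fin n) ℝ} {x : X}
    (hH : ∀ i j, DifferentiableAt ℝ (fun z => H z i j) x) (h0 : IsUnit (H x).det) (i j : Fin n) :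
    DifferentiableAt ℝ (fun z => (H z)⁻¹ i j) x := by
  simp only [Matrix.inv_def, Matrix.smul_apply, smul_eq_mul, Ring.inverse_eq_inv',
    Matrix.adjugate_apply]
  refine ((differentiableAt_det hH).fun_inv h0.ne_zero).mul (differentiableAt_det fun p q => ?_)
  by_cases hp : p = j
  · subst hp; simp
  · simpa [Matrix.updateRow_ne hp] using hH p q

/-- Differentiate H H⁻¹ = 1, which holds near `y` because the determinant stays nonzero. -/
theorem pd_inv_apply {H : EuclideanSpace ℝ (Fin n) → Matrix (Fin k) (Fin k) ℝ}
    {y : EuclideanSpace ℝ (Fin n)} (hH : ∀ i j, DifferentiableAt ℝ (fun z => H z i j) y)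
    (h0 : IsUnit (H y).det) (r : Fin n) (i j : Fin k) :
    pd r (fun z => (H z)⁻¹ i j) y =
      -∑ p, ∑ q, (H y)⁻¹ i p * pd r (fun z => H z p q) y * (H y)⁻¹ q j := by
  have hinv := differentiableAt_inv_apply hH h0
  have hev : ∀ᶠ z in 𝓝 y, IsUnit (H z).det := by
    filter_upwards [(differentiableAt_det hH).continuousAt.eventually_ne h0.ne_zero] with z hz
    exact hz.isUnit
  have h1 : ∀ p, ∑ q, (pd r (fun z => H z p q) y * (H y)⁻¹ q j +
      H y p q * pd r (fun z => (H z)⁻¹ q j) y) = 0 := by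
    intro p
    have h2 : (fun z => ∑ q, H z p q * (H z)⁻¹ q j) =ᶠ[𝓝 y]
        fun _ => (1 : Matrix (Fin k) (Fin k) ℝ) p j := by
      filter_upwards [hev] with z hz
      rw [← Matrix.mul_apply, Matrix.mul_nonsing_inv _ hz]
    have h3 := pd_congr h2 r
    rw [pd_sum fun q _ => (hH p q).fun_mul (hinv q j)] at h3
    simp only [pd_mul (hH _ _) (hinv _ _)] at h3
    rw [h3]
    simp [pd]
  set X : Matrix (Fin k) (Fin k) ℝ := Matrix.of fun p q => pd r (fun z => H z p q) y with hX
  set Y : Matrix (Fin k) (Fin k) ℝ := Matrix.of fun p q => pd r (fun z => (H z)⁻¹ p q) y with hY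
  have h4 : ∀ p, (X * (H y)⁻¹) p j + (H y * Y) p j = 0 := by
    intro p
    rw [Matrix.mul_apply, Matrix.mul_apply, ← Finset.sum_add_distrib]
    exact h1 p
  have h5 : Y i j = ((H y)⁻¹ * (H y * Y)) i j := by
    rw [Matrix.nonsing_inv_mul_cancel_left _ _ h0]
  change Y i j = _
  rw [h5, Matrix.mul_apply, ← Finset.sum_neg_distrib]
  refine Finset.sum_congr rfl fun p _ => ?_
  rw [eq_neg_of_add_eq_zero_right (h4 p), Matrix.mul_apply, mul_neg, Finset.mul_sum]
  simp only [mul_assoc]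
  rfl

/-- The Christoffel symbols of a matrix-valued function. -/
noncomputable def matrixChristoffel (H : EuclideanSpace ℝ (Fin n) → Matrix (Fin n) (Fin n) ℝ)
    (y : EuclideanSpace ℝ (Fin n)) (l i j : Fin n) : ℝ :=
  (1 / 2) * ∑ r, (H y)⁻¹ l r *
    (pd i (fun z => H z j r) y + pd j (fun z => H z i r) y - pd r (fun z => H z i j) y)

/-- The contracted Christoffel symbols: `√det H h^{ij} Γˡᵢⱼ = -∂ᵢ (√det H h^{il})`. -/
theorem sum_inv_mul_matrixChristoffel
    {H : EuclideanSpace ℝ (Fin n) → Matrix (Fin n) (Fin n) ℝ} {y : EuclideanSpace ℝ (Fin n)}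
    (hH : ∀ i j, DifferentiableAt ℝ (fun z => H z i j) y) (hpos : ∀ᶠ z in 𝓝 y, (H z).PosDef)
    (l : Fin n) :
    √(H y).det * ∑ i, ∑ j, (H y)⁻¹ i j * matrixChristoffel H y l i j =
      -∑ i, pd i (fun z => √(H z).det * (H z)⁻¹ i l) y := by
  have hy := hpos.self_of_nhds
  have h0 : IsUnit (H y).det := hy.det_pos.ne'.isUnit
  have hinv := differentiableAt_inv_apply hH h0
  set K := (H y)⁻¹ with hK
  have hKs : ∀ i j, K i j = K j i := fun i j => by simpa using (hy.1.inv.apply j i)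
  set d : Fin n → Fin n → Fin n → ℝ := fun r i j => pd r (fun z => H z i j) y with hd
  have hds : ∀ r i j, d r i j = d r j i := by
    intro r i j
    refine pd_congr ?_ r
    filter_upwards [hpos] with z hz
    simpa using hz.1.apply j i
  have hsd : DifferentiableAt ℝ (fun z => √(H z).det) y :=
    (differentiableAt_det hH).sqrt hy.det_pos.ne'
  have h1 : ∀ i, pd i (fun z => √(H z).det) y =
      √(H y).det * ((1 / 2) * ∑ p, ∑ q, K p q * d i q p) := by
    intro i
    have h2 : pd i (fun z => √(H z).det) y = 1 / (2 * √(H y).det) * pd i (fun z => (H z).det) y := by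
      have := ((differentiableAt_det hH).hasFDerivAt.sqrt hy.det_pos.ne').fderiv
      simp only [pd, this]
      simp
    rw [h2, pd_det hH h0]
    have h3 : √(H y).det ≠ 0 := (Real.sqrt_pos.mpr hy.det_pos).ne'
    field_simp
    rw [Real.sq_sqrt hy.det_pos.le]
  have h2 : ∀ i, pd i (fun z => √(H z).det * (H z)⁻¹ i l) y = √(H y).det *
      ((1 / 2) * (∑ p, ∑ q, K p q * d i q p) * K i l - ∑ p, ∑ q, K i p * d i p q * K q l) := by
    intro i
    rw [pd_mul hsd (hinv i l), h1, pd_inv_apply hH h0]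
    ring
  rw [Finset.sum_congr rfl fun i _ => h2 i, ← Finset.mul_sum, ← mul_neg]
  congr 1
  have h3 : ∑ i, ∑ j, K i j * matrixChristoffel H y l i j =
      ∑ r, (1 / 2) * K l r * ∑ i, ∑ j, K i j * (d i j r + d j i r - d r i j) := by
    simp only [matrixChristoffel, Finset.mul_sum]
    rw [Finset.sum_congr rfl fun i _ => Finset.sum_comm, Finset.sum_comm]
    refine Finset.sum_congr rfl fun r _ => Finset.sum_congr rfl fun i _ =>
      Finset.sum_congr rfl fun j _ => ?_
    simp only [hd]
    ring
  -- The symmetry of K merges the first two derivative terms of Γ. The third is the logarithmic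
  -- derivative of det H from Jacobi's formula.
  have h4 : ∀ r, ∑ i, ∑ j, K i j * (d i j r + d j i r - d r i j) =
      2 * (∑ i, ∑ j, K i j * d i j r) - ∑ i, ∑ j, K i j * d r j i := by
    intro r
    have h5 : ∑ i, ∑ j, K i j * d j i r = ∑ i, ∑ j, K i j * d i j r := by
      rw [Finset.sum_comm]
      refine Finset.sum_congr rfl fun i _ => Finset.sum_congr rfl fun j _ => ?_
      rw [hKs j i]
    have h6 : ∑ i, ∑ j, K i j * d r j i = ∑ i, ∑ j, K i j * d r i j :=
      Finset.sum_congr rfl fun i _ => Finset.sum_congr rfl fun j _ => by rw [hds r j i]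
    simp only [mul_sub, mul_add, Finset.sum_add_distrib, Finset.sum_sub_distrib]
    rw [h5, h6]
    ring
  have h5 : ∑ r, K l r * ∑ i, ∑ j, K i j * d i j r = ∑ i, ∑ p, ∑ q, K i p * d i p q * K q l := by
    simp only [Finset.mul_sum]
    rw [Finset.sum_comm]
    refine Finset.sum_congr rfl fun i _ => ?_
    rw [Finset.sum_comm]
    refine Finset.sum_congr rfl fun p _ => Finset.sum_congr rfl fun q _ => ?_
    rw [hKs l q]
    ring
  rw [h3, Finset.sum_sub_distrib, ← h5, neg_sub, ← Finset.sum_sub_distrib]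
  refine Finset.sum_congr rfl fun r _ => ?_
  rw [h4, hKs l r]
  ring

/-- A section `B = κ (√det H)⁻¹ √det G(u) h · g⁻¹(u) · T` of `T*M ⊗ u*TL` has divergence zero if
the coefficients `T` have divergence zero and `∂ᵢ uᶜ Tⁱ_b` is a multiple of the identity. -/
theorem divergence_eq_zero_of_coefficients
    {H : EuclideanSpace ℝ (Fin n) → Matrix (Fin n) (Fin n) ℝ} {y : EuclideanSpace ℝ (Fin n)}
    (hH : ∀ i j, DifferentiableAt ℝ (fun z => H z i j) y) (hHpos : ∀ᶠ z in 𝓝 y, (H z).PosDef)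
    {u : EuclideanSpace ℝ (Fin n) → EuclideanSpace ℝ (Fin k)} (hu : DifferentiableAt ℝ u y)
    {G : EuclideanSpace ℝ (Fin k) → Matrix (Fin k) (Fin k) ℝ}
    (hG : ∀ a b, DifferentiableAt ℝ (fun z => G z a b) (u y))
    (hGpos : ∀ᶠ z in 𝓝 (u y), (G z).PosDef)
    {B : Fin n → Fin k → EuclideanSpace ℝ (Fin n) → ℝ}
    {T : Fin n → Fin k → EuclideanSpace ℝ (Fin n) → ℝ} (hT : ∀ i b, DifferentiableAt ℝ (T i b) y)
    (hT0 : ∀ b, ∑ i, pd i (T i b) y = 0) {D κ : ℝ}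
    (hTD : ∀ b c, ∑ i, pd i (fun z => u z c) y * T i b y = if b = c then D else 0)
    (hB : ∀ᶠ z in 𝓝 y, ∀ j a, B j a z = κ * ∑ i, ∑ b, H z j i * (√(H z).det)⁻¹ *
      (√(G (u z)).det * (G (u z))⁻¹ b a) * T i b z) :
    (∀ j a, DifferentiableAt ℝ (B j a) y) ∧ ∀ a, ∑ i, ∑ j, (H y)⁻¹ i j *
      (pd i (B j a) y - ∑ l, matrixChristoffel H y l i j * B l a y +
        ∑ b, ∑ c, matrixChristoffel G (u y) a b c * pd i (fun z => u z b) y * B j c y) = 0 := by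
  have hHy := hHpos.self_of_nhds
  have hGy := hGpos.self_of_nhds
  have hH0 : IsUnit (H y).det := hHy.det_pos.ne'.isUnit
  have hG0 : IsUnit (G (u y)).det := hGy.det_pos.ne'.isUnit
  have hHs : 0 < √(H y).det := Real.sqrt_pos.mpr hHy.det_pos
  have hdH : DifferentiableAt ℝ (fun z => √(H z).det) y :=
    (differentiableAt_det hH).sqrt hHy.det_pos.ne'
  have hdW : ∀ b a, DifferentiableAt ℝ (fun z => √(G z).det * (G z)⁻¹ b a) (u y) := fun b a =>
    ((differentiableAt_det hG).sqrt hGy.det_pos.ne').fun_mul (differentiableAt_inv_apply hG hG0 b a)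
  have hdWu : ∀ b a, DifferentiableAt ℝ (fun z => √(G (u z)).det * (G (u z))⁻¹ b a) y :=
    fun b a => (hdW b a).comp y hu
  have hdK : ∀ i j, DifferentiableAt ℝ (fun z => √(H z).det * (H z)⁻¹ i j) y := fun i j =>
    hdH.fun_mul (differentiableAt_inv_apply hH hH0 i j)
  have hdB : ∀ j a, DifferentiableAt ℝ (B j a) y := by
    intro j a
    refine DifferentiableAt.congr_of_eventuallyEq ?_ (hB.mono fun z hz => hz j a)
    exact (DifferentiableAt.fun_sum fun i _ => DifferentiableAt.fun_sum fun b _ =>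
      (((hH j i).fun_mul (hdH.fun_inv hHs.ne')).fun_mul (hdWu b a)).fun_mul (hT i b)).const_mul κ
  refine ⟨hdB, fun a => ?_⟩
  -- Raising the index of B cancels both H and its density, leaving a flux in which the source
  -- metric no longer appears.
  have hP : ∀ᶠ z in 𝓝 y, ∀ i a, ∑ j, √(H z).det * (H z)⁻¹ i j * B j a z =
      κ * ∑ b, √(G (u z)).det * (G (u z))⁻¹ b a * T i b z := by
    filter_upwards [hB, hHpos] with z hz hHz i a
    have h1 : ∀ l, ∑ j, (H z)⁻¹ i j * H z j l = if i = l then 1 else 0 := fun l => by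
      rw [← Matrix.mul_apply, Matrix.nonsing_inv_mul _ hHz.det_pos.ne'.isUnit, Matrix.one_apply]
    have h2 : 0 < √(H z).det := Real.sqrt_pos.mpr hHz.det_pos
    have h3 : ∑ j, √(H z).det * (H z)⁻¹ i j * B j a z =
        κ * ∑ l, ∑ b, (∑ j, (H z)⁻¹ i j * H z j l) *
          (√(G (u z)).det * (G (u z))⁻¹ b a * T l b z) := by
      simp only [Finset.sum_mul, Finset.mul_sum]
      rw [Finset.sum_congr rfl fun l _ => Finset.sum_comm, Finset.sum_comm]
      refine Finset.sum_congr rfl fun j _ => ?_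
      rw [hz]
      simp only [Finset.mul_sum]
      refine Finset.sum_congr rfl fun l _ => Finset.sum_congr rfl fun b _ => ?_
      field_simp
    rw [h3]
    simp [h1]
  have hdiv1 : ∑ i, pd i (fun z => ∑ j, √(H z).det * (H z)⁻¹ i j * B j a z) y =
      √(H y).det * ∑ i, ∑ j, (H y)⁻¹ i j *
        (pd i (B j a) y - ∑ l, matrixChristoffel H y l i j * B l a y) := by
    have h1 : ∀ i, pd i (fun z => ∑ j, √(H z).det * (H z)⁻¹ i j * B j a z) y =
        ∑ j, (pd i (fun z => √(H z).det * (H z)⁻¹ i j) y * B j a y +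
          √(H y).det * (H y)⁻¹ i j * pd i (B j a) y) := by
      intro i
      rw [pd_sum fun j _ => (hdK i j).fun_mul (hdB j a)]
      exact Finset.sum_congr rfl fun j _ => pd_mul (hdK i j) (hdB j a) i
    have h2 : ∑ l, B l a y * ∑ i, pd i (fun z => √(H z).det * (H z)⁻¹ i l) y =
        -(√(H y).det * ∑ i, ∑ j, (H y)⁻¹ i j * ∑ l, matrixChristoffel H y l i j * B l a y) := by
      have h3 : ∀ l, ∑ i, pd i (fun z => √(H z).det * (H z)⁻¹ i l) y =
          -(√(H y).det * ∑ i, ∑ j, (H y)⁻¹ i j * matrixChristoffel H y l i j) := fun l => by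
        rw [sum_inv_mul_matrixChristoffel hH hHpos, neg_neg]
      simp only [h3, mul_neg, Finset.sum_neg_distrib, Finset.mul_sum]
      rw [Finset.sum_comm, Finset.sum_congr rfl fun i _ => Finset.sum_comm]
      congr 1
      refine Finset.sum_congr rfl fun i _ => Finset.sum_congr rfl fun j _ =>
        Finset.sum_congr rfl fun l _ => ?_
      ring
    rw [Finset.sum_congr rfl fun i _ => h1 i]
    simp only [Finset.sum_add_distrib, mul_sub, Finset.sum_sub_distrib]
    rw [sub_eq_add_neg, ← h2, Finset.sum_comm, add_comm]
    congr 1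
    · simp only [Finset.mul_sum, mul_assoc]
    · refine Finset.sum_congr rfl fun l _ => ?_
      rw [Finset.mul_sum]
      exact Finset.sum_congr rfl fun i _ => mul_comm _ _
  -- The other evaluation of the divergence of the flux: the derivative of T sums to zero, and the
  -- chain rule with `hTD` contracts the derivative of √det G G⁻¹ to a Christoffel trace of the
  -- target.
  have hdiv2 : ∑ i, pd i (fun z => ∑ j, √(H z).det * (H z)⁻¹ i j * B j a z) y =
      -(κ * D * √(G (u y)).det * ∑ b, ∑ c, (G (u y))⁻¹ b c * matrixChristoffel G (u y) a b c) := by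
    have h1 : ∀ i, pd i (fun z => ∑ j, √(H z).det * (H z)⁻¹ i j * B j a z) y =
        κ * ∑ b, ((∑ c, pd c (fun z => √(G z).det * (G z)⁻¹ b a) (u y) *
          pd i (fun z => u z c) y) * T i b y +
          √(G (u y)).det * (G (u y))⁻¹ b a * pd i (T i b) y) := by
      intro i
      rw [pd_congr (hP.mono fun z hz => hz i a), pd_const_mul (DifferentiableAt.fun_sum fun b _ =>
        (hdWu b a).fun_mul (hT i b)), pd_sum fun b _ => (hdWu b a).fun_mul (hT i b)]
      congr 1
      refine Finset.sum_congr rfl fun b _ => ?_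
      rw [pd_mul (hdWu b a) (hT i b), ← pd_comp hu (hdW b a)]
    have h2 : ∑ i, ∑ b, (∑ c, pd c (fun z => √(G z).det * (G z)⁻¹ b a) (u y) *
          pd i (fun z => u z c) y) * T i b y =
        ∑ b, ∑ c, pd c (fun z => √(G z).det * (G z)⁻¹ b a) (u y) *
          ∑ i, pd i (fun z => u z c) y * T i b y := by
      simp only [Finset.mul_sum, Finset.sum_mul]
      rw [Finset.sum_comm]
      refine Finset.sum_congr rfl fun b _ => ?_
      rw [Finset.sum_comm]
      simp only [mul_assoc]
    have h3 : ∑ i, ∑ b, √(G (u y)).det * (G (u y))⁻¹ b a * pd i (T i b) y = 0 := by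
      rw [Finset.sum_comm]
      simp only [← Finset.mul_sum, hT0, mul_zero, Finset.sum_const_zero]
    rw [Finset.sum_congr rfl fun i _ => h1 i, ← Finset.mul_sum]
    simp only [Finset.sum_add_distrib]
    rw [h2, h3, add_zero]
    simp only [hTD, mul_ite, mul_zero, Finset.sum_ite_eq, Finset.mem_univ, if_true]
    rw [← Finset.sum_mul]
    linear_combination κ * D * sum_inv_mul_matrixChristoffel hG hGpos a
  have hBy : ∀ i c, ∑ j, (H y)⁻¹ i j * B j c y =
      (√(H y).det)⁻¹ * (κ * ∑ b, √(G (u y)).det * (G (u y))⁻¹ b c * T i b y) := by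
    intro i c
    rw [← hP.self_of_nhds i c]
    simp only [mul_assoc, ← Finset.mul_sum]
    rw [inv_mul_cancel_left₀ hHs.ne']
  -- The connection term of u^*TL, again by `hTD`, is the same Christoffel trace with the opposite
  -- sign.
  have hthird : ∑ i, ∑ j, (H y)⁻¹ i j *
      ∑ b, ∑ c, matrixChristoffel G (u y) a b c * pd i (fun z => u z b) y * B j c y =
      (√(H y).det)⁻¹ * (κ * D * √(G (u y)).det *
        ∑ b, ∑ c, (G (u y))⁻¹ b c * matrixChristoffel G (u y) a b c) := by
    have h1 : ∑ i, ∑ j, (H y)⁻¹ i j *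
        ∑ b, ∑ c, matrixChristoffel G (u y) a b c * pd i (fun z => u z b) y * B j c y =
        ∑ b, ∑ c, matrixChristoffel G (u y) a b c * ∑ i, pd i (fun z => u z b) y *
          ∑ j, (H y)⁻¹ i j * B j c y := by
      simp only [Finset.mul_sum]
      rw [Finset.sum_congr rfl fun i _ => Finset.sum_comm, Finset.sum_comm]
      refine Finset.sum_congr rfl fun b _ => ?_
      rw [Finset.sum_congr rfl fun i _ => Finset.sum_comm, Finset.sum_comm]
      refine Finset.sum_congr rfl fun c _ => Finset.sum_congr rfl fun i _ =>
        Finset.sum_congr rfl fun j _ => ?_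
      ring
    have h2 : ∀ b c, ∑ i, pd i (fun z => u z b) y * ∑ j, (H y)⁻¹ i j * B j c y =
        (√(H y).det)⁻¹ * (κ * D * √(G (u y)).det * (G (u y))⁻¹ b c) := by
      intro b c
      have h3 : ∑ i, pd i (fun z => u z b) y * ∑ j, (H y)⁻¹ i j * B j c y =
          ∑ d, (√(H y).det)⁻¹ * (κ * (√(G (u y)).det * (G (u y))⁻¹ d c)) *
            ∑ i, pd i (fun z => u z b) y * T i d y := by
        simp only [hBy, Finset.mul_sum]
        rw [Finset.sum_comm]
        refine Finset.sum_congr rfl fun d _ => Finset.sum_congr rfl fun i _ => ?_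
        ring
      rw [h3]
      simp only [hTD, mul_ite, mul_zero, Finset.sum_ite_eq', Finset.mem_univ, if_true]
      ring
    rw [h1, Finset.sum_congr rfl fun b _ => Finset.sum_congr rfl fun c _ => by rw [h2]]
    simp only [Finset.mul_sum]
    refine Finset.sum_congr rfl fun b _ => Finset.sum_congr rfl fun c _ => ?_
    ring
  simp only [mul_add, Finset.sum_add_distrib]
  have h1 := hdiv1.symm.trans hdiv2
  rw [hthird]
  rw [← mul_right_inj' hHs.ne', mul_add, h1, mul_inv_cancel_left₀ hHs.ne', mul_zero,
    neg_add_cancel]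

end Calculus

/-! ### Independence of the basis for the metric trace and the volume form -/

section Bases

variable {V : Type*} [AddCommGroup V] [Module ℝ V] {n : ℕ}

theorem gram_basis_change (b b' : Module.Basis (Fin n) ℝ V) (B : V →ₗ[ℝ] V →ₗ[ℝ] ℝ) :
    gram (fun v w => B v w) b' =
      (b.toMatrix b').transpose * gram (fun v w => B v w) b * b.toMatrix b' := by
  ext i j
  simp only [gram, Matrix.of_apply]
  conv_lhs => rw [← b.sum_toMatrix_smul_self b' i, ← b.sum_toMatrix_smul_self b' j]
  simp only [map_sum, map_smul, LinearMap.sum_apply, LinearMap.smul_apply, smul_eq_mul,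
    Matrix.mul_apply, Matrix.transpose_apply, Finset.sum_mul, Matrix.of_apply, Finset.mul_sum]
  refine Finset.sum_congr rfl fun p _ => Finset.sum_congr rfl fun q _ => ?_
  ring

theorem isUnit_det_toMatrix (b b' : Module.Basis (Fin n) ℝ V) : IsUnit (b.toMatrix b').det :=
  b.isUnit_det b'

theorem metricTrace_basis_change (b b' : Module.Basis (Fin n) ℝ V) (H B : V →ₗ[ℝ] V →ₗ[ℝ] ℝ) :
    metricTrace b' (fun v w => H v w) (fun v w => B v w) =
      metricTrace b (fun v w => H v w) (fun v w => B v w) := by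
  have h1 : ∀ b : Module.Basis (Fin n) ℝ V,
      metricTrace b (fun v w => H v w) (fun v w => B v w) =
      ((gram (fun v w => H v w) b)⁻¹ * (gram (fun v w => B v w) b).transpose).trace := by
    intro b
    simp [metricTrace, Matrix.trace, Matrix.mul_apply, gram]
  have hM := isUnit_det_toMatrix b b'
  rw [h1, h1, gram_basis_change b b', gram_basis_change b b' B]
  set M := b.toMatrix b'
  have hMt : IsUnit M.transpose.det := by rwa [Matrix.det_transpose]
  rw [Matrix.mul_inv_rev, Matrix.mul_inv_rev, Matrix.transpose_mul, Matrix.transpose_mul,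
    Matrix.transpose_transpose, Matrix.mul_assoc, Matrix.trace_mul_comm]
  simp only [Matrix.mul_assoc]
  rw [Matrix.mul_nonsing_inv _ hM, Matrix.mul_one, ← Matrix.mul_assoc M.transpose⁻¹,
    Matrix.nonsing_inv_mul _ hMt, Matrix.one_mul]

theorem volumeForm_basis_change (b b' : Module.Basis (Fin n) ℝ V) (H : V →ₗ[ℝ] V →ₗ[ℝ] ℝ)
    (o : Orientation ℝ V (Fin n)) :
    volumeForm b (fun v w => H v w) o = volumeForm b' (fun v w => H v w) o := by
  have hdet : b.det = b.det b' • b'.det := b.det.eq_smul_basis_det b'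
  have h1 : √(gram (fun v w => H v w) b').det =
      |b.det b'| * √(gram (fun v w => H v w) b).det := by
    rw [gram_basis_change b b', Matrix.det_mul, Matrix.det_mul, Matrix.det_transpose,
      mul_right_comm, ← sq, Real.sqrt_mul (sq_nonneg _), Real.sqrt_sq_eq_abs]
    rfl
  have h2 : b.det b' ≠ 0 := (b.isUnit_det b').ne_zero
  have h0 := b.orientation_eq_iff_det_pos b'
  simp only [volumeForm]
  generalize b.det b' = D at *
  rw [h1, hdet, smul_smul]
  congr 1
  -- The density scales by |D| and the determinant form by D; when D < 0 the orientation sign flips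
  -- and compensates.
  rcases h2.lt_or_gt with hneg | hpos
  · have h3 : b.orientation ≠ b'.orientation := fun h =>
      absurd (h0.mp h) hneg.not_gt
    have h4 : b'.orientation = o ↔ ¬ b.orientation = o := by
      constructor
      · rintro rfl; exact h3
      · intro h
        rcases b.orientation_eq_or_eq_neg o with h5 | h5
        · exact absurd h5.symm h
        · rcases b.orientation_eq_or_eq_neg b'.orientation with h6 | h6
          · exact absurd h6.symm h3
          · rw [h5, h6]
    rw [abs_of_neg hneg]
    by_cases h : b.orientation = o <;> simp only [h, h4] <;> simp [mul_comm]
  · rw [abs_of_pos hpos, h0.mpr hpos]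
    ring

end Bases

/-! ### Metrics and volume forms in the preferred charts -/

section Charts

variable {n : ℕ} {M : Type*} [TopologicalSpace M] [ChartedSpace (EuclideanSpace ℝ (Fin n)) M]

/-- The derivative of the preferred chart at `x₀`, at the point `x`. -/
noncomputable def chartDeriv (x₀ x : M) : TangentSpace (𝓡 n) x →L[ℝ] EuclideanSpace ℝ (Fin n) :=
  mfderiv (𝓡 n) 𝓘(ℝ, EuclideanSpace ℝ (Fin n)) (extChartAt (𝓡 n) x₀) x

theorem coordMap_eq_mfderivWithin (x₀ : M) (y : EuclideanSpace ℝ (Fin n)) :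
    coordMap x₀ y = mfderivWithin 𝓘(ℝ, EuclideanSpace ℝ (Fin n)) (𝓡 n)
      (extChartAt (𝓡 n) x₀).symm (Set.range (𝓡 n)) y := by
  rw [ModelWithCorners.range_eq_univ, mfderivWithin_univ]
  rfl

theorem eventually_mem_target (x₀ : M) :
    ∀ᶠ y in 𝓝 (extChartAt (𝓡 n) x₀ x₀), y ∈ (extChartAt (𝓡 n) x₀).target :=
  extChartAt_target_mem_nhds x₀

variable [IsManifold (𝓡 n) ∞ M]

theorem chartDeriv_coordMap {x₀ : M} {y : EuclideanSpace ℝ (Fin n)}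
    (hy : y ∈ (extChartAt (𝓡 n) x₀).target) (v : EuclideanSpace ℝ (Fin n)) :
    chartDeriv x₀ ((extChartAt (𝓡 n) x₀).symm y) (coordMap x₀ y v) = v := by
  rw [coordMap_eq_mfderivWithin]
  exact congrArg (fun f => f v) (mfderiv_extChartAt_comp_mfderivWithin_extChartAt_symm hy)

theorem coordMap_chartDeriv {x₀ : M} {y : EuclideanSpace ℝ (Fin n)}
    (hy : y ∈ (extChartAt (𝓡 n) x₀).target)
    (v : TangentSpace (𝓡 n) ((extChartAt (𝓡 n) x₀).symm y)) :
    coordMap x₀ y (chartDeriv x₀ ((extChartAt (𝓡 n) x₀).symm y) v) = v := by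
  rw [coordMap_eq_mfderivWithin]
  exact congrArg (fun f => f v) (mfderivWithin_extChartAt_symm_comp_mfderiv_extChartAt hy)

/-- The tangent space at x₀ is modelled through the preferred chart at x₀, so that chart has
identity derivative at its own centre. Hence `tangentBasis` is the coordinate basis there, and
`divergence` can be evaluated in chart coordinates. -/
theorem chartDeriv_self (x₀ : M) (v : TangentSpace (𝓡 n) x₀) : chartDeriv x₀ x₀ v = v := by
  have h := TangentBundle.continuousLinearMapAt_trivializationAt (𝕜 := ℝ) (I := 𝓡 n)
    (mem_chart_source (EuclideanSpace ℝ (Fin n)) x₀)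
  rw [TangentBundle.continuousLinearMapAt_trivializationAt_eq_core
    (mem_chart_source (EuclideanSpace ℝ (Fin n)) x₀)] at h
  rw [chartDeriv, ← h]
  exact (tangentBundleCore (𝓡 n) M).coordChange_self _ _ (mem_chart_source _ x₀) v

/-- The coordinate map as a linear equivalence. -/
noncomputable def coordEquiv {x₀ : M} {y : EuclideanSpace ℝ (Fin n)}
    (hy : y ∈ (extChartAt (𝓡 n) x₀).target) :
    EuclideanSpace ℝ (Fin n) ≃ₗ[ℝ] TangentSpace (𝓡 n) ((extChartAt (𝓡 n) x₀).symm y) :=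
  LinearEquiv.ofLinearMap (coordMap x₀ y).toLinearMap
    (chartDeriv x₀ ((extChartAt (𝓡 n) x₀).symm y)).toLinearMap
    (LinearMap.ext fun v => coordMap_chartDeriv hy v)
    (LinearMap.ext fun v => chartDeriv_coordMap hy v)

/-- The coordinate basis. -/
noncomputable def coordBasis {x₀ : M} {y : EuclideanSpace ℝ (Fin n)}
    (hy : y ∈ (extChartAt (𝓡 n) x₀).target) :
    Module.Basis (Fin n) ℝ (TangentSpace (𝓡 n) ((extChartAt (𝓡 n) x₀).symm y)) :=
  (EuclideanSpace.basisFun (Fin n) ℝ).toBasis.map (coordEquiv hy)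

theorem coe_coordBasis {x₀ : M} {y : EuclideanSpace ℝ (Fin n)}
    (hy : y ∈ (extChartAt (𝓡 n) x₀).target) :
    ⇑(coordBasis hy) = fun i => coordVec x₀ i y := by
  funext i
  change coordMap x₀ y ((EuclideanSpace.basisFun (Fin n) ℝ).toBasis i) = _
  rw [OrthonormalBasis.coe_toBasis, EuclideanSpace.basisFun_apply]
  rfl

/-- The inner product of a Riemannian metric as a bilinear map. -/
noncomputable def ipBilin (h : RiemMetric n M) (x : M) :
    TangentSpace (𝓡 n) x →ₗ[ℝ] TangentSpace (𝓡 n) x →ₗ[ℝ] ℝ :=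
  LinearMap.mk₂ ℝ (fun v w => ip h x v w) (by simp [ip]) (by simp [ip]) (by simp [ip])
    (by simp [ip])

/-- The matrix of a Riemannian metric in the preferred chart at `x₀`. -/
noncomputable def chartGram (h : RiemMetric n M) (x₀ : M) (y : EuclideanSpace ℝ (Fin n)) :
    Matrix (Fin n) (Fin n) ℝ :=
  gram (ip h ((extChartAt (𝓡 n) x₀).symm y)) fun i => coordVec x₀ i y

theorem ip_coordMap (h : RiemMetric n M) (x₀ : M) (y v w : EuclideanSpace ℝ (Fin n)) :
    ip h ((extChartAt (𝓡 n) x₀).symm y) (coordMap x₀ y v) (coordMap x₀ y w) =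
      ∑ p, ∑ q, v p * chartGram h x₀ y p q * w q := by
  have h1 : ∀ v : EuclideanSpace ℝ (Fin n), coordMap x₀ y v = ∑ p, v p • coordVec x₀ p y := by
    intro v
    conv_lhs => rw [← (EuclideanSpace.basisFun (Fin n) ℝ).sum_repr v]
    rw [map_sum]
    refine Finset.sum_congr rfl fun p _ => ?_
    rw [map_smul]
    simp [coordVec]
  change ipBilin h _ _ _ = _
  rw [h1 v, h1 w]
  simp only [map_sum, map_smul, LinearMap.sum_apply, LinearMap.smul_apply, smul_eq_mul, Finset.mul_sum]
  rw [Finset.sum_comm]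
  refine Finset.sum_congr rfl fun p _ => Finset.sum_congr rfl fun q _ => ?_
  rw [mul_comm]
  rfl

theorem posDef_chartGram (h : RiemMetric n M) {x₀ : M} {y : EuclideanSpace ℝ (Fin n)}
    (hy : y ∈ (extChartAt (𝓡 n) x₀).target) : (chartGram h x₀ y).PosDef := by
  refine Matrix.PosDef.of_dotProduct_mulVec_pos ?_ fun v hv => ?_
  · ext i j
    exact h.symm _ _ _
  · have h1 := ip_coordMap h x₀ y (WithLp.toLp 2 v) (WithLp.toLp 2 v)
    have h2 : coordMap x₀ y (WithLp.toLp 2 v) ≠ 0 := by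
      intro h0
      have := chartDeriv_coordMap hy (WithLp.toLp 2 v)
      rw [h0, map_zero] at this
      exact hv (congrArg WithLp.ofLp this.symm)
    have h3 := h.pos _ _ h2
    have h4 : star v ⬝ᵥ (chartGram h x₀ y).mulVec v =
        ∑ p, ∑ q, v p * chartGram h x₀ y p q * v q := by
      simp [dotProduct, Matrix.mulVec, Finset.mul_sum, mul_assoc]
    rw [h4]
    exact h3.trans_eq h1

theorem ip_eq_sum_chartGram (h : RiemMetric n M) {x₀ x : M} (hx : x ∈ (extChartAt (𝓡 n) x₀).source)
    (v w : TangentSpace (𝓡 n) x) :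
    ip h x v w = ∑ p, ∑ q, chartDeriv x₀ x v p *
      chartGram h x₀ (extChartAt (𝓡 n) x₀ x) p q * chartDeriv x₀ x w q := by
  obtain ⟨y, hy, rfl⟩ : ∃ y ∈ (extChartAt (𝓡 n) x₀).target, (extChartAt (𝓡 n) x₀).symm y = x :=
    ⟨_, (extChartAt (𝓡 n) x₀).map_source hx, (extChartAt (𝓡 n) x₀).left_inv hx⟩
  rw [(extChartAt (𝓡 n) x₀).right_inv hy, ← ip_coordMap, coordMap_chartDeriv hy,
    coordMap_chartDeriv hy]

theorem gram_tangentBasis (h : RiemMetric n M) (x₀ : M) :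
    gram (ip h x₀) (tangentBasis x₀) = chartGram h x₀ (extChartAt (𝓡 n) x₀ x₀) := by
  ext i j
  simp only [gram, Matrix.of_apply]
  rw [ip_eq_sum_chartGram h (mem_extChartAt_source x₀), chartDeriv_self, chartDeriv_self]
  have h1 : ∀ i : Fin n, (show EuclideanSpace ℝ (Fin n) from tangentBasis x₀ i) =
      EuclideanSpace.single i 1 := fun i => by
    change (EuclideanSpace.basisFun (Fin n) ℝ).toBasis i = _
    rw [OrthonormalBasis.coe_toBasis, EuclideanSpace.basisFun_apply]
  change ∑ p, ∑ q, (show EuclideanSpace ℝ (Fin n) from tangentBasis x₀ i) p * _ *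
    (show EuclideanSpace ℝ (Fin n) from tangentBasis x₀ j) q = _
  rw [h1, h1, Finset.sum_eq_single i, Finset.sum_eq_single j] <;> simp +contextual

theorem differentiableAt_chartGram (h : RiemMetric n M) (x₀ : M) (i j : Fin n) :
    DifferentiableAt ℝ (fun y => chartGram h x₀ y i j) (extChartAt (𝓡 n) x₀ x₀) := by
  set y₀ := extChartAt (𝓡 n) x₀ x₀ with hy₀
  have hsymm : ContMDiffAt 𝓘(ℝ, EuclideanSpace ℝ (Fin n)) (𝓡 n) ∞ (extChartAt (𝓡 n) x₀).symm y₀ :=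
    (contMDiffOn_extChartAt_symm x₀).contMDiffAt (extChartAt_target_mem_nhds x₀)
  have hx : (extChartAt (𝓡 n) x₀).symm y₀ = x₀ := extChartAt_to_inv x₀
  have hvec : ∀ i, ContMDiffAt 𝓘(ℝ, EuclideanSpace ℝ (Fin n))
      ((𝓡 n).prod 𝓘(ℝ, EuclideanSpace ℝ (Fin n))) ∞
      (fun y => Bundle.TotalSpace.mk' (EuclideanSpace ℝ (Fin n))
        (E := (TangentSpace (𝓡 n) : M → Type _)) ((extChartAt (𝓡 n) x₀).symm y)
        (coordVec x₀ i y)) y₀ := by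
    intro i
    rw [Bundle.contMDiffAt_totalSpace]
    refine ⟨hsymm, ?_⟩
    -- Read in the trivialization at x₀, a coordinate field is constant, since the trivialization is
    -- the derivative of the chart.
    refine (contMDiffAt_const (c := EuclideanSpace.single i (1 : ℝ))).congr_of_eventuallyEq ?_
    filter_upwards [eventually_mem_target x₀] with y hy
    rw [hx]
    have hys : (extChartAt (𝓡 n) x₀).symm y ∈ (chartAt (EuclideanSpace ℝ (Fin n)) x₀).source := by
      rw [← extChartAt_source (𝓡 n)]
      exact (extChartAt (𝓡 n) x₀).map_target hy
    have h1 := TangentBundle.continuousLinearMapAt_trivializationAt (𝕜 := ℝ) (I := 𝓡 n) hys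
    have h2 := congrArg (fun f => f (coordVec x₀ i y)) h1
    refine Eq.trans ?_ (h2.trans (chartDeriv_coordMap hy _))
    rw [Bundle.Trivialization.continuousLinearMapAt_apply,
      Bundle.Trivialization.coe_linearMapAt_of_mem _ hys]
  have h1 : ContMDiffAt 𝓘(ℝ, EuclideanSpace ℝ (Fin n)) ((𝓡 n).prod 𝓘(ℝ)) ∞
      (fun y => Bundle.TotalSpace.mk' ℝ (E := Bundle.Trivial M ℝ) ((extChartAt (𝓡 n) x₀).symm y)
        (h.inner _ (coordVec x₀ i y) (coordVec x₀ j y))) y₀ := by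
    apply ContMDiffAt.clm_bundle_apply₂ (F₁ := EuclideanSpace ℝ (Fin n))
      (F₂ := EuclideanSpace ℝ (Fin n))
    · exact ContMDiffAt.comp y₀ h.contMDiff.contMDiffAt hsymm
    · exact hvec i
    · exact hvec j
  rw [Bundle.contMDiffAt_totalSpace] at h1
  exact (contMDiffAt_iff_contDiffAt.mp h1.2).differentiableAt (by simp)

/-- Near x₀ the orientation is constant in the trivialization, so a single sign relates the
Riemannian volume form to the coordinate one. A sign varying with the point could not be carried
through differentiation. -/
theorem exists_eventually_riemVol_eq (h : RiemMetric n M) (o : ManifoldOrientation n M) (x₀ : M) :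
    ∃ s : ℝ, |s| = 1 ∧ ∀ᶠ x in 𝓝 x₀, riemVol h o x =
      (s * √(chartGram h x₀ (extChartAt (𝓡 n) x₀ x)).det) •
        (EuclideanSpace.basisFun (Fin n) ℝ).toBasis.det.compLinearMap
          (chartDeriv x₀ x).toLinearMap := by
  classical
  obtain ⟨o₀, ho₀⟩ := o.locally_const x₀
  refine ⟨if (EuclideanSpace.basisFun (Fin n) ℝ).toBasis.orientation = o₀ then 1 else -1, ?_, ?_⟩
  · split_ifs <;> simp
  filter_upwards [ho₀, extChartAt_source_mem_nhds (I := 𝓡 n) x₀] with x hx hxs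
  have hxs' : x ∈ (chartAt (EuclideanSpace ℝ (Fin n)) x₀).source := by
    rwa [← extChartAt_source (𝓡 n)]
  have hx1 := hx hxs'
  obtain ⟨y, hy, rfl⟩ : ∃ y ∈ (extChartAt (𝓡 n) x₀).target, (extChartAt (𝓡 n) x₀).symm y = x :=
    ⟨_, (extChartAt (𝓡 n) x₀).map_source hxs, (extChartAt (𝓡 n) x₀).left_inv hxs⟩
  have h1 : riemVol h o ((extChartAt (𝓡 n) x₀).symm y) =
      volumeForm (coordBasis hy) (ip h _) (o.at_ _) :=
    volumeForm_basis_change (tangentBasis _) (coordBasis hy) (ipBilin h _) _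
  have h2 : ((trivializationAt (EuclideanSpace ℝ (Fin n))
      (TangentSpace (𝓡 n) : M → Type _) x₀).continuousLinearEquivAt ℝ _ hxs').toLinearEquiv =
      (coordEquiv hy).symm := by
    ext v : 1
    refine (congrArg (fun f => f v) (Bundle.Trivialization.coe_continuousLinearEquivAt_eq
      (R := ℝ) (trivializationAt (EuclideanSpace ℝ (Fin n)) (TangentSpace (𝓡 n) : M → Type _) x₀)
      hxs')).trans ?_
    exact congrArg (fun f => f v)
      (TangentBundle.continuousLinearMapAt_trivializationAt (𝕜 := ℝ) (I := 𝓡 n) hxs')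
  rw [h2] at hx1
  have h3 : (coordBasis hy).orientation = o.at_ _ ↔
      (EuclideanSpace.basisFun (Fin n) ℝ).toBasis.orientation = o₀ := by
    rw [coordBasis, Module.Basis.orientation_map, ← hx1, ← Equiv.eq_symm_apply,
      Orientation.map_symm]
  rw [h1, (extChartAt (𝓡 n) x₀).right_inv hy]
  simp only [volumeForm, h3]
  rw [coe_coordBasis]
  congr 1

end Charts

/-! ### The differential, its norm and the k-differential in coordinates -/

section Maps

variable {n k : ℕ} {M L : Type*}
  [TopologicalSpace M] [ChartedSpace (EuclideanSpace ℝ (Fin n)) M]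
  [TopologicalSpace L] [ChartedSpace (EuclideanSpace ℝ (Fin k)) L]
  [IsManifold (𝓡 n) ∞ M] [IsManifold (𝓡 k) ∞ L]

/-- The components `∂ⱼ ûᶜ` of the differential in coordinates. -/
noncomputable def coordJacobian (u : M → L) (x₀ : M) (y : EuclideanSpace ℝ (Fin n)) :
    Fin k → Fin n → ℝ :=
  fun c j => pd j (fun z => coordRep u x₀ z c) y

omit [IsManifold (𝓡 n) ∞ M] [IsManifold (𝓡 k) ∞ L] in
theorem eventually_mem_source_of_continuous {u : M → L} (hu : Continuous u) (x₀ : M) :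
    ∀ᶠ y in 𝓝 (extChartAt (𝓡 n) x₀ x₀),
      u ((extChartAt (𝓡 n) x₀).symm y) ∈ (extChartAt (𝓡 k) (u x₀)).source := by
  have h1 : Filter.Tendsto (fun y => u ((extChartAt (𝓡 n) x₀).symm y))
      (𝓝 (extChartAt (𝓡 n) x₀ x₀)) (𝓝 (u x₀)) := by
    have h2 : Filter.Tendsto (extChartAt (𝓡 n) x₀).symm (𝓝 (extChartAt (𝓡 n) x₀ x₀)) (𝓝 x₀) := by
      have := continuousAt_extChartAt_symm (I := 𝓡 n) x₀
      rwa [ContinuousAt, extChartAt_to_inv] at this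
    exact hu.continuousAt.tendsto.comp h2
  exact h1 (extChartAt_source_mem_nhds (I := 𝓡 k) (u x₀))

theorem contDiffAt_coordRep {u : M → L} (hu : ContMDiff (𝓡 n) (𝓡 k) ∞ u) {x₀ : M}
    {y : EuclideanSpace ℝ (Fin n)} (hy : y ∈ (extChartAt (𝓡 n) x₀).target)
    (huy : u ((extChartAt (𝓡 n) x₀).symm y) ∈ (extChartAt (𝓡 k) (u x₀)).source) :
    ContDiffAt ℝ ∞ (coordRep (k := k) u x₀) y := by
  rw [← contMDiffAt_iff_contDiffAt]
  have h1 : ContMDiffAt 𝓘(ℝ, EuclideanSpace ℝ (Fin n)) (𝓡 n) ∞ (extChartAt (𝓡 n) x₀).symm y :=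
    (contMDiffOn_extChartAt_symm x₀).contMDiffAt ((isOpen_extChartAt_target x₀).mem_nhds hy)
  have h2 : ContMDiffAt (𝓡 k) 𝓘(ℝ, EuclideanSpace ℝ (Fin k)) ∞ (extChartAt (𝓡 k) (u x₀))
      (u ((extChartAt (𝓡 n) x₀).symm y)) :=
    contMDiffAt_extChartAt' (by rwa [← extChartAt_source (𝓡 k)])
  exact (h2.comp (f := fun z => u ((extChartAt (𝓡 n) x₀).symm z)) y (hu.contMDiffAt.comp y h1))

theorem chartDeriv_differential_coordMap {u : M → L} (hu : ContMDiff (𝓡 n) (𝓡 k) ∞ u) {x₀ : M}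
    {y : EuclideanSpace ℝ (Fin n)} (hy : y ∈ (extChartAt (𝓡 n) x₀).target)
    (huy : u ((extChartAt (𝓡 n) x₀).symm y) ∈ (extChartAt (𝓡 k) (u x₀)).source)
    (v : EuclideanSpace ℝ (Fin n)) :
    chartDeriv (u x₀) _ (differential u ((extChartAt (𝓡 n) x₀).symm y) (coordMap x₀ y v)) =
      fderiv ℝ (coordRep (k := k) u x₀) y v := by
  have h1 : MDifferentiableAt 𝓘(ℝ, EuclideanSpace ℝ (Fin n)) (𝓡 n) (extChartAt (𝓡 n) x₀).symm y :=
    ((contMDiffOn_extChartAt_symm (n := ∞) x₀).contMDiffAt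
      ((isOpen_extChartAt_target x₀).mem_nhds hy)).mdifferentiableAt (by simp)
  have h2 : MDifferentiableAt (𝓡 k) 𝓘(ℝ, EuclideanSpace ℝ (Fin k)) (extChartAt (𝓡 k) (u x₀))
      (u ((extChartAt (𝓡 n) x₀).symm y)) :=
    mdifferentiableAt_extChartAt (by rwa [← extChartAt_source (𝓡 k)])
  have h3 : MDifferentiableAt (𝓡 n) (𝓡 k) u ((extChartAt (𝓡 n) x₀).symm y) :=
    hu.contMDiffAt.mdifferentiableAt (by simp)
  have h4 := (h2.hasMFDerivAt.comp y (h3.hasMFDerivAt.comp y h1.hasMFDerivAt)).mfderiv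
  rw [← mfderiv_eq_fderiv]
  exact (congrArg (fun f => f v) h4).symm

theorem fderiv_coordRep_single {u : M → L} (hu : ContMDiff (𝓡 n) (𝓡 k) ∞ u) {x₀ : M}
    {y : EuclideanSpace ℝ (Fin n)} (hy : y ∈ (extChartAt (𝓡 n) x₀).target)
    (huy : u ((extChartAt (𝓡 n) x₀).symm y) ∈ (extChartAt (𝓡 k) (u x₀)).source)
    (j : Fin n) (c : Fin k) :
    fderiv ℝ (coordRep (k := k) u x₀) y (EuclideanSpace.single j 1) c = coordJacobian u x₀ y c j := by
  have := ((EuclideanSpace.proj c : EuclideanSpace ℝ (Fin k) →L[ℝ] ℝ).hasFDerivAt.comp y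
    ((contDiffAt_coordRep hu hy huy).differentiableAt (by simp)).hasFDerivAt).fderiv
  exact (congrArg (fun L => L (EuclideanSpace.single j 1)) this).symm

theorem normDu_symm {u : M → L} (hu : ContMDiff (𝓡 n) (𝓡 k) ∞ u) (h : RiemMetric n M)
    (g : RiemMetric k L) {x₀ : M}
    {y : EuclideanSpace ℝ (Fin n)} (hy : y ∈ (extChartAt (𝓡 n) x₀).target)
    (huy : u ((extChartAt (𝓡 n) x₀).symm y) ∈ (extChartAt (𝓡 k) (u x₀)).source) :
    normDu h g u ((extChartAt (𝓡 n) x₀).symm y) =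
      √(energy (chartGram h x₀ y) (chartGram g (u x₀) (coordRep u x₀ y))
        (coordJacobian u x₀ y) (coordJacobian u x₀ y)) := by
  set x := (extChartAt (𝓡 n) x₀).symm y with hx
  set B : TangentSpace (𝓡 n) x →ₗ[ℝ] TangentSpace (𝓡 n) x →ₗ[ℝ] ℝ :=
    (ipBilin g (u x)).compl₁₂ (differential u x).toLinearMap (differential u x).toLinearMap with hB
  have h1 := metricTrace_basis_change (tangentBasis x) (coordBasis hy) (ipBilin h x) B
  unfold normDu
  congr 1
  refine h1.symm.trans ?_
  unfold metricTrace energy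
  rw [coe_coordBasis]
  refine Finset.sum_congr rfl fun i _ => Finset.sum_congr rfl fun j _ => ?_
  congr 1
  refine (ip_eq_sum_chartGram g huy _ _).trans ?_
  refine Finset.sum_congr rfl fun a _ => Finset.sum_congr rfl fun b _ => ?_
  have h2 : ∀ (i : Fin n) (a : Fin k),
      chartDeriv (u x₀) (u x) (differential u x (coordVec x₀ i y)) a =
      coordJacobian u x₀ y a i := by
    intro i a
    rw [coordVec, chartDeriv_differential_coordMap hu hy huy, fderiv_coordRep_single hu hy huy]
  refine congrArg₂ (· * ·) (congrArg₂ (· * ·) (h2 i a) rfl) (h2 j b)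

theorem coordComp_pDifferential {u : M → L} (hu : ContMDiff (𝓡 n) (𝓡 k) ∞ u) (h : RiemMetric n M)
    (g : RiemMetric k L) (hk : 2 ≤ k) {x₀ : M}
    {y : EuclideanSpace ℝ (Fin n)} (hy : y ∈ (extChartAt (𝓡 n) x₀).target)
    (huy : u ((extChartAt (𝓡 n) x₀).symm y) ∈ (extChartAt (𝓡 k) (u x₀)).source)
    (j : Fin n) (a : Fin k) :
    coordComp (pDifferential (k : ℝ) h g u) x₀ j a y =
      √(energy (chartGram h x₀ y) (chartGram g (u x₀) (coordRep u x₀ y))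
        (coordJacobian u x₀ y) (coordJacobian u x₀ y)) ^ (k - 2) * coordJacobian u x₀ y a j := by
  -- With a natural exponent, k = 2 gives the power 0, equal to 1 even where du vanishes, as for
  -- `Real.rpow`.
  have h1 : (k : ℝ) - 2 = ((k - 2 : ℕ) : ℝ) := by push_cast [hk]; ring
  have h2 : coordComp (pDifferential (k : ℝ) h g u) x₀ j a y =
      (chartDeriv (u x₀) _ ((normDu h g u ((extChartAt (𝓡 n) x₀).symm y) ^ ((k : ℝ) - 2)) •
        differential u ((extChartAt (𝓡 n) x₀).symm y) (coordVec x₀ j y))) a := rfl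
  rw [h2, map_smul, coordVec, chartDeriv_differential_coordMap hu hy huy, PiLp.smul_apply,
    fderiv_coordRep_single hu hy huy, normDu_symm hu h g hy huy, h1, Real.rpow_natCast, smul_eq_mul]

end Maps

/-! ### The Smith equation in coordinates and the formula for the k-differential -/

section Smith

variable {m k : ℕ} {M L : Type*}
  [TopologicalSpace M] [ChartedSpace (EuclideanSpace ℝ (Fin (m + k))) M]
  [TopologicalSpace L] [ChartedSpace (EuclideanSpace ℝ (Fin k)) L]
  [IsManifold (𝓡 (m + k)) ∞ M] [IsManifold (𝓡 k) ∞ L]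

theorem abs_chartForm_le {h : RiemMetric (m + k) M} {α : SmoothForm (m + k) M m}
    (hα : IsCalibration h α) (x₀ : M) (y : EuclideanSpace ℝ (Fin (m + k)))
    (v : Fin m → EuclideanSpace ℝ (Fin (m + k))) :
    |chartForm α.at_ x₀ y v| ≤ √(gram (fun x z : EuclideanSpace ℝ (Fin (m + k)) =>
      ∑ p, ∑ q, x p * chartGram h x₀ y p q * z q) v).det := by
  refine (hα _ _).trans (le_of_eq ?_)
  congr 2
  ext i j
  exact ip_coordMap h x₀ y (v i) (v j)

/-- The Smith equation in coordinates. -/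
theorem exists_eventually_rowWedge_eq {h : RiemMetric (m + k) M} {oM : ManifoldOrientation (m + k) M}
    {g : RiemMetric k L} {oL : ManifoldOrientation k L} {α : SmoothForm (m + k) M m} {u : M → L}
    (hu : IsSmithSubmersion h oM g oL α u) (x₀ : M) :
    ∃ s : ℝ, |s| = 1 ∧ ∀ᶠ y in 𝓝 (extChartAt (𝓡 (m + k)) x₀ x₀),
      s * √(chartGram g (u x₀) (coordRep u x₀ y)).det *
        rowWedge (chartForm α.at_ x₀ y).toAlternatingMap (coordJacobian u x₀ y) =
      m.factorial * √(chartGram h x₀ y).det *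
        (√(energy (chartGram h x₀ y) (chartGram g (u x₀) (coordRep u x₀ y))
          (coordJacobian u x₀ y) (coordJacobian u x₀ y)) / √k) ^ k := by
  obtain ⟨sM, hsM, hM⟩ := exists_eventually_riemVol_eq h oM x₀
  obtain ⟨sL, hsL, hL⟩ := exists_eventually_riemVol_eq g oL (u x₀)
  refine ⟨sM * sL, by rw [abs_mul, hsM, hsL, one_mul], ?_⟩
  have hcont : Filter.Tendsto (extChartAt (𝓡 (m + k)) x₀).symm
      (𝓝 (extChartAt (𝓡 (m + k)) x₀ x₀)) (𝓝 x₀) := by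
    have := continuousAt_extChartAt_symm (I := 𝓡 (m + k)) x₀
    rwa [ContinuousAt, extChartAt_to_inv] at this
  have hucont : Filter.Tendsto u (𝓝 x₀) (𝓝 (u x₀)) := hu.smooth.continuous.continuousAt
  filter_upwards [hcont.eventually hM, (hucont.comp hcont).eventually hL,
    eventually_mem_target x₀, eventually_mem_source_of_continuous (n := m + k) (k := k) hu.smooth.continuous x₀]
    with y hMy hLy hy huy
  set e : Fin (m + k) → EuclideanSpace ℝ (Fin (m + k)) := fun i => EuclideanSpace.single i 1 with he
  set D := (EuclideanSpace.basisFun (Fin k) ℝ).toBasis.det with hD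
  set x := (extChartAt (𝓡 (m + k)) x₀).symm y with hx
  -- Both sides have top degree, so evaluating on the coordinate frame loses nothing.
  have h1 := congrArg (fun f => f.compLinearMap (coordMap x₀ y).toLinearMap e) (hu.smith_eq x)
  replace hLy : riemVol g oL (u x) = _ := hLy
  have h2 : ((riemVol g oL (u x)).compLinearMap (differential u x).toLinearMap).compLinearMap
      (coordMap x₀ y).toLinearMap =
      (sL * √(chartGram g (u x₀) (coordRep u x₀ y)).det) •
        D.compLinearMap (fderiv ℝ (coordRep (k := k) u x₀) y).toLinearMap := by
    rw [hLy]
    ext v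
    have h3 : (fun i => chartDeriv (u x₀) (u x) (differential u x (coordMap x₀ y (v i)))) =
        fun i => fderiv ℝ (coordRep (k := k) u x₀) y (v i) :=
      funext fun i => chartDeriv_differential_coordMap hu.smooth hy huy (v i)
    exact congrArg (fun w => (sL * √(chartGram g (u x₀) (coordRep u x₀ y)).det) • D w) h3
  have h3 : (riemVol h oM x).compLinearMap (coordMap x₀ y).toLinearMap e =
      sM * √(chartGram h x₀ y).det := by
    rw [hMy, (extChartAt (𝓡 (m + k)) x₀).right_inv hy]
    have h4 : (fun i => chartDeriv x₀ x (coordMap x₀ y (e i))) =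
        (EuclideanSpace.basisFun (Fin (m + k)) ℝ).toBasis := by
      funext i
      rw [chartDeriv_coordMap hy, OrthonormalBasis.coe_toBasis, EuclideanSpace.basisFun_apply]
    refine (congrArg (fun w => (sM * √(chartGram h x₀ y).det) •
      (EuclideanSpace.basisFun (Fin (m + k)) ℝ).toBasis.det w) h4).trans ?_
    rw [Module.Basis.det_self, smul_eq_mul, mul_one]
  have h4 : (sL * √(chartGram g (u x₀) (coordRep u x₀ y)).det) *
      wedge (chartForm α.at_ x₀ y).toAlternatingMap
        (D.compLinearMap (fderiv ℝ (coordRep (k := k) u x₀) y).toLinearMap) e =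
      (1 / √(k : ℝ) ^ k * normDu h g u x ^ k) * (sM * √(chartGram h x₀ y).det) := by
    rw [← h3]
    refine Eq.trans ?_ h1
    rw [← wedge_compLinearMap, h2, wedge_smul_right]
    rfl
  have h5 := factorial_mul_wedge (chartForm α.at_ x₀ y).toAlternatingMap
    (fderiv ℝ (coordRep (k := k) u x₀) y).toLinearMap
  have h6 : (fun (c : Fin k) j => (fderiv ℝ (coordRep (k := k) u x₀) y).toLinearMap
      (EuclideanSpace.single j 1) c) = coordJacobian u x₀ y := by
    funext c j
    exact fderiv_coordRep_single hu.smooth hy huy j c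
  rw [h6] at h5
  rw [← h5, ← normDu_symm hu.smooth h g hy huy, div_pow]
  have h7 : sM * sM = 1 := by rw [← abs_mul_abs_self, hsM, one_mul]
  linear_combination (m.factorial * sM : ℝ) * h4 +
    (1 / √(k : ℝ) ^ k * normDu h g u x ^ k) * √(chartGram h x₀ y).det * m.factorial * h7

/-- The equation satisfied by the `k`-differential of a Smith submersion in coordinates. -/
theorem exists_eventually_coordComp_eq (hk : 2 ≤ k) {h : RiemMetric (m + k) M}
    {oM : ManifoldOrientation (m + k) M} {g : RiemMetric k L} {oL : ManifoldOrientation k L}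
    {α : SmoothForm (m + k) M m} (hα : IsCalibration h α) {u : M → L}
    (hu : IsSmithSubmersion h oM g oL α u) (x₀ : M) :
    ∃ κ : ℝ, ∀ᶠ y in 𝓝 (extChartAt (𝓡 (m + k)) x₀ x₀), ∀ (j : Fin (m + k)) (a : Fin k),
      coordComp (pDifferential (k : ℝ) h g u) x₀ j a y =
      κ * ∑ i, ∑ b, chartGram h x₀ y j i * (√(chartGram h x₀ y).det)⁻¹ *
        (√(chartGram g (u x₀) (coordRep u x₀ y)).det *
          (chartGram g (u x₀) (coordRep u x₀ y))⁻¹ b a) *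
        rowWedge (chartForm α.at_ x₀ y).toAlternatingMap
          (Function.update (coordJacobian u x₀ y) b (Pi.single i 1)) := by
  obtain ⟨s, hs, hev⟩ := exists_eventually_rowWedge_eq hu x₀
  have hk0 : (0 : ℝ) < k := by exact_mod_cast (by omega : 0 < k)
  -- Inverse of the constant in the first variation formula, with s⁻¹ = s. The rest inverts the
  -- contraction with H⁻¹ and G.
  refine ⟨s / (m.factorial * (k / √k ^ k)), ?_⟩
  filter_upwards [hev, eventually_mem_target x₀,
    eventually_mem_source_of_continuous (n := m + k) (k := k) hu.smooth.continuous x₀]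
    with y hy hyt huy j a
  rw [coordComp_pDifferential hu.smooth h g hk hyt huy]
  have hH := posDef_chartGram h hyt
  have hG : (chartGram g (u x₀) (coordRep u x₀ y)).PosDef :=
    posDef_chartGram g ((extChartAt (𝓡 k) (u x₀)).map_source huy)
  have key := rowWedge_update_of_comass_eq hk hH hG (chartForm α.at_ x₀ y).toAlternatingMap
    (abs_chartForm_le hα x₀ y) (coordJacobian u x₀ y) hs hy
  set H := chartGram h x₀ y
  set G := chartGram g (u x₀) (coordRep u x₀ y)
  set β : Fin k → Fin (m + k) → ℝ := coordJacobian u x₀ y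
  set N := √(energy H G β β) ^ (k - 2)
  have hHs : 0 < √H.det := Real.sqrt_pos.mpr hH.det_pos
  have hs2 : s * s = 1 := by rw [← abs_mul_abs_self, hs, one_mul]
  have hsymm : ∀ i j, H i j = H j i := fun i j => by simpa using hH.1.apply j i
  have hHinv : ∀ l, ∑ i, H⁻¹ l i * H j i = if l = j then 1 else 0 := fun l => by
    simp only [hsymm j]
    rw [← Matrix.mul_apply, Matrix.nonsing_inv_mul _ hH.det_pos.ne'.isUnit, Matrix.one_apply]
  have hGinv : ∀ c, ∑ b, G c b * G⁻¹ b a = if c = a then 1 else 0 := fun c => by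
    rw [← Matrix.mul_apply, Matrix.mul_nonsing_inv _ hG.det_pos.ne'.isUnit, Matrix.one_apply]
  have hterm : ∀ i b, H j i * (√H.det)⁻¹ * (√G.det * G⁻¹ b a) *
      rowWedge (chartForm α.at_ x₀ y).toAlternatingMap (Function.update β b (Pi.single i 1)) =
      s * (m.factorial * (k / √k ^ k)) * N * ∑ l, ∑ c, β c l * (H⁻¹ l i * H j i) *
        (G c b * G⁻¹ b a) := by
    intro i b
    have h1 : √G.det * rowWedge (chartForm α.at_ x₀ y).toAlternatingMap
        (Function.update β b (Pi.single i 1)) =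
        s * (m.factorial * √H.det * (k / √k ^ k) * N * ∑ j, ∑ a, H⁻¹ j i * β a j * G a b) := by
      rw [← key b i]
      linear_combination -(√G.det * rowWedge (chartForm α.at_ x₀ y).toAlternatingMap
        (Function.update β b (Pi.single i 1))) * hs2
    have h2 : ∑ l, ∑ c, β c l * (H⁻¹ l i * H j i) * (G c b * G⁻¹ b a) =
        (∑ l, ∑ c, H⁻¹ l i * β c l * G c b) * (H j i * G⁻¹ b a) := by
      simp only [Finset.sum_mul]
      refine Finset.sum_congr rfl fun l _ => Finset.sum_congr rfl fun c _ => ?_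
      ring
    have h3 : (√H.det)⁻¹ * √H.det = 1 := inv_mul_cancel₀ hHs.ne'
    rw [h2]
    linear_combination H j i * (√H.det)⁻¹ * G⁻¹ b a * h1 + H j i * G⁻¹ b a * s *
      (m.factorial * (k / √k ^ k) * N * ∑ j, ∑ a, H⁻¹ j i * β a j * G a b) * h3
  have hsum : ∑ i, ∑ b, ∑ l, ∑ c, β c l * (H⁻¹ l i * H j i) * (G c b * G⁻¹ b a) = β a j := by
    have h1 : ∑ i, ∑ b, ∑ l, ∑ c, β c l * (H⁻¹ l i * H j i) * (G c b * G⁻¹ b a) =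
        ∑ l, ∑ c, β c l * (∑ i, H⁻¹ l i * H j i) * (∑ b, G c b * G⁻¹ b a) := by
      simp only [Finset.mul_sum, Finset.sum_mul]
      rw [Finset.sum_congr rfl fun i _ => Finset.sum_comm, Finset.sum_comm]
      refine Finset.sum_congr rfl fun l _ => ?_
      rw [Finset.sum_congr rfl fun i _ => Finset.sum_comm, Finset.sum_comm]
      refine Finset.sum_congr rfl fun c _ => ?_
      rw [Finset.sum_comm]
    rw [h1]
    simp only [hHinv, hGinv]
    simp
  rw [Finset.sum_congr rfl fun i _ => Finset.sum_congr rfl fun b _ => hterm i b]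
  simp only [← Finset.mul_sum]
  rw [hsum]
  have hfac : (m.factorial : ℝ) * (k / √k ^ k) ≠ 0 := by positivity
  field_simp
  linear_combination -(N * β a j) * hs2

end Smith

end SmithSubmersion

/-! ### The main theorem -/

open SmithSubmersion in
theorem mainTheorem5 (m k : ℕ) (hk : 2 ≤ k)
    (M : Type*) [TopologicalSpace M] [ChartedSpace (EuclideanSpace ℝ (Fin (m + k))) M]
    [IsManifold (𝓡 (m + k)) ∞ M]
    (L : Type*) [TopologicalSpace L] [ChartedSpace (EuclideanSpace ℝ (Fin k)) L]
    [IsManifold (𝓡 k) ∞ L]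
    (h : RiemMetric (m + k) M) (oM : ManifoldOrientation (m + k) M)
    (g : RiemMetric k L) (oL : ManifoldOrientation k L)
    (α : SmoothForm (m + k) M m) (hα : IsCalibration h α) (hdα : α.IsClosed)
    (u : M → L) (hu : IsSmithSubmersion h oM g oL α u) :
    ∀ x : M, (pDifferential (k : ℝ) h g u).DifferentiableAt x ∧ pTension (k : ℝ) h g u x = 0 := by
  intro x₀
  set y₀ := extChartAt (𝓡 (m + k)) x₀ x₀ with hy₀
  obtain ⟨κ, hB⟩ := exists_eventually_coordComp_eq hk hα hu x₀
  have hyt : y₀ ∈ (extChartAt (𝓡 (m + k)) x₀).target := mem_extChartAt_target x₀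
  have hx₀ : (extChartAt (𝓡 (m + k)) x₀).symm y₀ = x₀ := extChartAt_to_inv x₀
  have huy : u ((extChartAt (𝓡 (m + k)) x₀).symm y₀) ∈ (extChartAt (𝓡 k) (u x₀)).source := by
    rw [hx₀]; exact mem_extChartAt_source (u x₀)
  have huy₀ : coordRep u x₀ y₀ = extChartAt (𝓡 k) (u x₀) (u x₀) := by rw [coordRep, hx₀]
  have hcr := contDiffAt_coordRep hu.smooth hyt huy
  have hcrc : ∀ c : Fin k, ContDiffAt ℝ 2 (fun z => coordRep u x₀ z c) y₀ := fun c =>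
    ((EuclideanSpace.proj c : EuclideanSpace ℝ (Fin k) →L[ℝ] ℝ).contDiff.contDiffAt.comp y₀
      hcr).of_le (WithTop.coe_le_coe.mpr (le_top : (2 : ℕ∞) ≤ ⊤))
  have hαd : DifferentiableAt ℝ (chartForm α.at_ x₀) y₀ :=
    ((α.smooth x₀).contDiffAt (extChartAt_target_mem_nhds x₀)).differentiableAt (by simp)
  obtain ⟨hd, hdiv⟩ := divergence_eq_zero_of_coefficients (y := y₀) (H := chartGram h x₀)
    (u := coordRep u x₀) (G := chartGram g (u x₀))
    (B := fun j a => coordComp (pDifferential (k : ℝ) h g u) x₀ j a)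
    -- T is the cofactor array of du¹, …, du^k against `α`, and D is the full wedge coefficient at
    -- the centre of the chart.
    (T := fun i b y => rowWedge (chartForm α.at_ x₀ y).toAlternatingMap
      (Function.update (coordJacobian u x₀ y) b (Pi.single i 1)))
    (D := rowWedge (chartForm α.at_ x₀ y₀).toAlternatingMap (coordJacobian u x₀ y₀)) (κ := κ)
    (differentiableAt_chartGram h x₀)
    ((eventually_mem_target x₀).mono fun y hy => posDef_chartGram h hy)
    (hcr.differentiableAt (by simp))
    (by rw [huy₀]; exact differentiableAt_chartGram g (u x₀))
    (by rw [huy₀]; exact (eventually_mem_target (u x₀)).mono fun y hy => posDef_chartGram g hy)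
    (fun i b => differentiableAt_rowWedge (fun v =>
      (ContinuousAlternatingMap.apply ℝ (EuclideanSpace ℝ (Fin (m + k))) ℝ v).differentiableAt.comp
        y₀ hαd) (fun c j => by
        by_cases hc : c = b
        · subst hc; simp
        · simp only [Function.update_of_ne hc]
          exact differentiableAt_pd (hcrc c) j))
    (fun b => sum_pd_rowWedge_eq_zero hαd (hdα x₀ y₀ hyt) hcrc b)
    (fun b c => sum_row_mul_rowWedge_update _ (coordJacobian u x₀ y₀) b c) hB
  refine ⟨hd, ?_⟩
  rw [huy₀] at hdiv
  unfold pTension divergence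
  refine Finset.sum_eq_zero fun a _ => ?_
  rw [gram_tangentBasis]
  exact (congrArg (· • tangentBasis (u x₀) a) (hdiv a)).trans (zero_smul ℝ _)
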